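/- Let $\mathcal H$ be the Butcher--Connes--Kreimer Hopf algebra over $\mathbb R$: the free commutative algebra on the (non-empty, unlabelled, non-planar) rooted trees, with the empty tree $\emptyset$ as unit, with coproduct $\Delta(\tau)=\tau\otimes\emptyset+\sum_c P_c(\tau)\otimes R_c(\tau)$, where $c$ runs over the admissible sets of edges of $\tau$ (at most one edge on each path from the root to a leaf; the empty set is included), $R_c(\tau)$ is the component of the root after deletion of $c$, and $P_c(\tau)$ is the product of the other components, and with antipode $S(\tau)=\sum_{c\subseteq E(\tau)}(-1)^{|c|+1}\tau^c$, where $\tau^c$ is the product of the components of $\tau$ after deletion of $c$. Let $\mu$ be the multiplication, $|\tau|$ the number of vertices of $\tau$, $\bar S(\tau)=(-1)^{|\tau|}S(\tau)$, and let $\mathrm{Id}^{1/2}$ be the unique multiplicative map $\phi:\mathcal H\to\mathcal H$ with $\mu\circ(\phi\otimes\phi)\circ\Delta=\mathrm{Id}$. Define multiplicative maps on $\mathcal H$ by $$\tau^-=\mu\circ(\bar S\otimes\mathrm{Id})\circ\Delta\circ\mathrm{Id}^{1/2}(\tau),\qquad \tau^+=\mu\circ(\mathrm{Id}\otimes((\cdot)^-\circ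 S))\circ\Delta(\tau).$$ For an $s$-stage Runge--Kutta scheme with real matrix $A=(a_{ij})$ and weights $b=(b_i)$, and nodes $c_i=\sum_j a_{ij}$, let $\psi:\mathcal H\to\mathbb R$ be the multiplicative linear extension of its elementary weights $\psi(\tau)=\sum_i b_i\,(\psi_iD)(\tau)$, where $(\psi_iD)([\tau_1,\dots,\tau_k])=\prod_{l=1}^k\sum_j a_{ij}(\psi_jD)(\tau_l)$. Here $[\tau_1,\dots,\tau_k]$ is the tree obtained by joining the roots of $\tau_1,\dots,\tau_k$ to a new root ($k=0$ gives the one-vertex tree). With the tree factorial $[\tau_1,\dots,\tau_k]!=|[\tau_1,\dots,\tau_k]|\,\tau_1!\cdots\tau_k!$, let $$\mathrm{ord}(\psi)=\sup\{n\in\mathbb N:\psi(\tau)=1/\tau!\ \text{ for all } \tau \text{ with } 1\le|\tau|\le n\},$$ $$\mathrm{ord}^+(\psi)=\sup\{n\in\mathbb N:\psi(\tau^+)=0\ \text{ for all } \tau \text{ with } 1\le|\tau|\le n\}.$$ The class $\mathrm{EES}(n,m)$ consists of the explicit schemes ($a_{ij}=0$ for $i\le j$) with $\mathrm{ord}(\psi)=n$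 and $\mathrm{ord}^+(\psi)=m$ (both exactly). **Proposition.** A $3$-stage Runge--Kutta scheme belongs to $\mathrm{EES}(2,5)$ if and only if, for some $x\in\mathbb R$ with $x\ne1$ and $x\neq\pm\tfrac12$, it is the scheme $\mathrm{EES}(2,5;x)$ with Butcher tableau $$\begin{array}{c|ccc}0&&&\\ \frac{1+2x}{4(1-x)}&\frac{1+2x}{4(1-x)}&&\\ \frac{3}{4(1-x)}&\frac{(4x-1)^2}{4(x-1)(1-4x^2)}&\frac{1-x}{1-4x^2}&\\ \hline &x&\frac12&\frac12-x\end{array}$$ In particular, $\mathrm{EES}(2,5;\tfrac14)$ and $\mathrm{EES}(2,5;\tfrac1{10})$ are the schemes $$\begin{array}{c|ccc}0&&&\\ \frac12&\frac12&&\\ 1&0&1&\\ \hline&\frac14&\frac12&\frac14\end{array}\qquad\text{and}\qquad\begin{array}{c|ccc}0&&&\\ \frac13&\frac13&&\\ \frac56&-\frac5{48}&\frac{15}{16}&\\ \hline&\frac1{10}&\frac12&\frac25\end{array}$$ -/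

import Mathlib

open scoped TensorProduct

namespace EES

/-! ### Non-planar rooted trees -/

/-- Planar (ordered) non-empty rooted trees: `dot` is the one-vertex tree, and `graft t u` is the
tree obtained from `u` by joining the root of `t` to the root of `u` as a new first child.
Every planar rooted tree is obtained in exactly one way. -/
inductive PTree : Type
  | dot : PTree
  | graft : PTree → PTree → PTree

/-- Two planar trees are isomorphic as (non-planar) rooted trees: the congruence generated by
exchanging two neighbouring children of a vertex. -/
inductive PTree.Iso : PTree → PTree → Prop
  | refl (t : PTree) : PTree.Iso t t
  | symm {t u : PTree} : PTree.Iso t u → PTree.Iso u t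
  | trans {t u v : PTree} : PTree.Iso t u → PTree.Iso u v → PTree.Iso t v
  | congr {t t' u u' : PTree} : PTree.Iso t t' → PTree.Iso u u' →
      PTree.Iso (PTree.graft t u) (PTree.graft t' u')
  | swap (t u v : PTree) :
      PTree.Iso (PTree.graft t (PTree.graft u v)) (PTree.graft u (PTree.graft t v))

instance PTree.setoid : Setoid PTree where
  r := PTree.Iso
  iseqv := ⟨PTree.Iso.refl, PTree.Iso.symm, PTree.Iso.trans⟩

/-- The set of non-empty unlabelled non-planar rooted trees.  The empty tree is the unit of the
algebra `H` below. -/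
def RTree : Type := Quotient PTree.setoid

/-- Forests: finite multisets of non-empty rooted trees. -/
abbrev Forest : Type := Multiset RTree

namespace RTree

/-- The one-vertex tree. -/
def dot : RTree := Quotient.mk PTree.setoid PTree.dot

/-- Join the root of the first tree, as a new child, to the root of the second. -/
def graft : RTree → RTree → RTree :=
  Quotient.map₂ PTree.graft fun _ _ h _ _ k => PTree.Iso.congr h k

instance graft_leftCommutative : LeftCommutative graft where
  left_comm := by
    rintro ⟨t⟩ ⟨u⟩ ⟨v⟩
    exact Quotient.sound (PTree.Iso.swap t u v)

/-- `node {τ₁, …, τₖ} = [τ₁, …, τₖ]`: join the roots of the trees of a forest to a new root. -/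
def node (F : Forest) : RTree := F.foldr graft dot

theorem node_zero : node 0 = dot := rfl

theorem node_cons (t : RTree) (F : Forest) : node (t ::ₘ F) = graft t (node F) :=
  Multiset.foldr_cons graft dot t F

end RTree

/-- The values of a function `f` on the trees hanging off the root, where `f` is given recursively
by `f [τ₁, …, τₖ] = g {f τ₁, …, f τₖ}`. -/
def PTree.foldChildren {α : Type} (g : Multiset α → α) : PTree → Multiset α
  | PTree.dot => 0
  | PTree.graft t u => g (PTree.foldChildren g t) ::ₘ PTree.foldChildren g u

theorem PTree.foldChildren_congr {α : Type} (g : Multiset α → α) {t u : PTree}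
    (h : PTree.Iso t u) : t.foldChildren g = u.foldChildren g := by
  induction h with
  | refl t => rfl
  | symm _ ih => exact ih.symm
  | trans _ _ ih₁ ih₂ => exact ih₁.trans ih₂
  | congr _ _ ih₁ ih₂ => simp only [PTree.foldChildren, ih₁, ih₂]
  | swap t u v => exact Multiset.cons_swap _ _ _

namespace RTree

def foldChildren {α : Type} (g : Multiset α → α) : RTree → Multiset α :=
  Quotient.lift (PTree.foldChildren g) fun _ _ h => PTree.foldChildren_congr g h

/-- The function `f` on trees with `f [τ₁, …, τₖ] = g {f τ₁, …, f τₖ}`. -/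
def fold {α : Type} (g : Multiset α → α) (τ : RTree) : α := g (foldChildren g τ)

theorem foldChildren_node {α : Type} (g : Multiset α → α) (F : Forest) :
    foldChildren g (node F) = F.map (fold g) := by
  induction F using Multiset.induction_on with
  | empty => rfl
  | cons t F ih =>
    rw [node_cons, Multiset.map_cons, ← ih]
    generalize node F = u
    induction t using Quotient.inductionOn
    induction u using Quotient.inductionOn
    rfl

theorem fold_node {α : Type} (g : Multiset α → α) (F : Forest) :
    fold g (node F) = g (F.map (fold g)) := by
  rw [fold, foldChildren_node]

theorem node_induction {p : RTree → Prop} (h : ∀ F : Forest, (∀ t ∈ F, p t) → p (node F))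
    (τ : RTree) : p τ := by
  suffices H : ∃ F : Forest, node F = τ ∧ ∀ t ∈ F, p t by
    obtain ⟨F, rfl, hF⟩ := H
    exact h F hF
  induction τ using Quotient.inductionOn with
  | h t =>
    induction t with
    | dot => exact ⟨0, rfl, by simp⟩
    | graft t u iht ihu =>
      obtain ⟨F, hF, hp⟩ := iht
      obtain ⟨G, hG, hq⟩ := ihu
      refine ⟨node F ::ₘ G, ?_, ?_⟩
      · rw [node_cons, hF, hG]
        rfl
      · intro s hs
        rcases Multiset.mem_cons.1 hs with rfl | hs
        · exact h F hp
        · exact hq s hs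

/-- The function `f` on trees with `f [τ₁, …, τₖ] = g {(τ₁, f τ₁), …, (τₖ, f τₖ)}`. -/
def para {α : Type} (g : Multiset (RTree × α) → α) (τ : RTree) : α :=
  (fold (fun s => (node (s.map Prod.fst), g s)) τ).2

theorem para_node {α : Type} (g : Multiset (RTree × α) → α) (F : Forest) :
    para g (node F) = g (F.map fun t => (t, para g t)) := by
  have key : ∀ t : RTree, fold (fun s => (node (s.map Prod.fst), g s)) t = (t, para g t) := by
    intro t
    refine Prod.ext ?_ rfl
    induction t using node_induction with
    | h F ih =>
      rw [fold_node]
      simp only [Multiset.map_map, Function.comp_apply]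
      rw [Multiset.map_congr rfl ih, Multiset.map_id']
  unfold para
  rw [fold_node]
  simp only [key]

/-- The number of vertices `|τ|`. -/
def size : RTree → ℕ := fold fun s => s.sum + 1

theorem size_node (F : Forest) : size (node F) = (F.map size).sum + 1 := fold_node _ F

/-- The tree factorial `[τ₁, …, τₖ]! = |[τ₁, …, τₖ]| · τ₁! ⋯ τₖ!`. -/
def factorial : RTree → ℕ :=
  para fun s => size (node (s.map Prod.fst)) * (s.map Prod.snd).prod

/-- The admissible cuts of `τ` other than the total cut (the empty cut is included), listed with
multiplicity as the pairs `(P, R)` of the pruned forest and the trunk containing the root.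
For each child `t` of the root one either cuts the edge above `t` (then `t` falls into `P` and no
further edge of `t` may be cut), or chooses an admissible cut of `t`.  `Multiset.Sections` lists
the ways to make one choice for each child. -/
def admissibleCuts : RTree → Multiset (Forest × RTree) :=
  para fun s =>
    (Multiset.Sections (s.map fun p =>
      (({p.1}, 0) : Forest × Forest) ::ₘ p.2.map fun c => (c.1, {c.2}))).map
        fun ch => ((ch.map Prod.fst).sum, node (ch.map Prod.snd).sum)

/-- All sets `c` of edges of `τ`, listed as the triples `(|c|, R, P)` of the number of edges of
`c`, the component `R` of the root in `τ` without the edges of `c`, and the forest `P` of the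
other components.  For each child `t` of the root one chooses a set of edges of `t`, and then
keeps or removes the edge above `t`. -/
def edgeCuts : RTree → Multiset (ℕ × RTree × Forest) :=
  para fun s =>
    (Multiset.Sections (s.map fun p =>
      (p.2.map fun c => ((c.1, {c.2.1}, c.2.2) : ℕ × Forest × Forest)) +
        p.2.map fun c => (c.1 + 1, 0, c.2.1 ::ₘ c.2.2))).map
          fun ch => ((ch.map fun x => x.1).sum, node (ch.map fun x => x.2.1).sum,
            (ch.map fun x => x.2.2).sum)

open Classical in
/-- The admissible cuts other than the empty cut and the total cut. -/
noncomputable def properCuts (τ : RTree) : Multiset (Forest × RTree) :=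
  (admissibleCuts τ).filter fun c => c.1 ≠ 0

theorem size_pos (τ : RTree) : 0 < size τ := Nat.succ_pos _

theorem size_of_mem_admissibleCuts (τ : RTree) :
    ∀ c ∈ admissibleCuts τ, (c.1.map size).sum + size c.2 = size τ := by
  induction τ using node_induction with
  | h F ih =>
    intro c hc
    rw [admissibleCuts, para_node, Multiset.mem_map] at hc
    obtain ⟨ch, hch, rfl⟩ := hc
    rw [size_node, size_node, ← add_assoc]
    congr 1
    rw [Multiset.map_map] at hch
    induction F using Multiset.induction_on generalizing ch with
    | empty =>
      simp only [Multiset.map_zero, Multiset.sections_zero, Multiset.mem_singleton] at hch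
      subst hch
      simp
    | cons t F ihF =>
      rw [Multiset.map_cons, Multiset.sections_cons, Multiset.mem_bind] at hch
      obtain ⟨x, hx, hch⟩ := hch
      rw [Multiset.mem_map] at hch
      obtain ⟨ch, hch, rfl⟩ := hch
      have h1 := ihF (fun t ht => ih t (Multiset.mem_cons_of_mem ht)) ch hch
      have h2 : (x.1.map size).sum + (x.2.map size).sum = size t := by
        rcases Multiset.mem_cons.1 hx with rfl | hx
        · simp
        · rw [Multiset.mem_map] at hx
          obtain ⟨c, hc, rfl⟩ := hx
          have := ih t (Multiset.mem_cons_self t F) c hc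
          simpa using this
      rw [Multiset.map_cons, Multiset.sum_cons, Multiset.map_cons, Multiset.sum_cons,
        Multiset.map_cons, Multiset.sum_cons, Multiset.map_add, Multiset.sum_add,
        Multiset.map_add, Multiset.sum_add]
      dsimp only at h1 ⊢
      omega

theorem size_trunk_lt {τ : RTree} {c : Forest × RTree} (hc : c ∈ properCuts τ) :
    size c.2 < size τ := by
  classical
  obtain ⟨h, h0⟩ := Multiset.mem_filter.1 hc
  have h1 := size_of_mem_admissibleCuts τ c h
  obtain ⟨t, ht⟩ := Multiset.exists_mem_of_ne_zero h0
  have h2 := Multiset.single_le_sum (fun _ _ => Nat.zero_le _) _ (Multiset.mem_map_of_mem size ht)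
  have h3 := size_pos t
  omega

theorem size_pruned_lt {τ : RTree} {c : Forest × RTree} (hc : c ∈ properCuts τ) {t : RTree}
    (ht : t ∈ c.1) : size t < size τ := by
  classical
  obtain ⟨h, -⟩ := Multiset.mem_filter.1 hc
  have h1 := size_of_mem_admissibleCuts τ c h
  have h2 := Multiset.single_le_sum (fun _ _ => Nat.zero_le _) _ (Multiset.mem_map_of_mem size ht)
  have h3 := size_pos c.2
  omega

end RTree

/-! ### The Butcher-Connes-Kreimer Hopf algebra -/

/-- The free commutative `ℝ`-algebra on the non-empty rooted trees; its unit is the empty tree. -/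
abbrev H : Type := MvPolynomial RTree ℝ

/-- A tree as an element of `H`. -/
noncomputable abbrev tree (τ : RTree) : H := MvPolynomial.X τ

/-- A forest as an element of `H`: the product of its trees. -/
noncomputable def forest (F : Forest) : H := (F.map tree).prod

/-- The coproduct, `Δ τ = τ ⊗ ∅ + ∑ P_c(τ) ⊗ R_c(τ)`; the first summand is the total cut. -/
noncomputable def coproduct : H →ₐ[ℝ] H ⊗[ℝ] H :=
  MvPolynomial.aeval fun τ =>
    tree τ ⊗ₜ[ℝ] (1 : H) +
      ((RTree.admissibleCuts τ).map fun c => forest c.1 ⊗ₜ[ℝ] tree c.2).sum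

/-- The antipode, `S τ = ∑ (-1)^(|c| + 1) τ^c` over all sets `c` of edges of `τ`. -/
noncomputable def antipode : H →ₐ[ℝ] H :=
  MvPolynomial.aeval fun τ =>
    ((RTree.edgeCuts τ).map fun c => (-1 : H) ^ (c.1 + 1) * (tree c.2.1 * forest c.2.2)).sum

/-- The canonical involution `τ ↦ (-1)^|τ| τ`. -/
noncomputable def involution : H →ₐ[ℝ] H :=
  MvPolynomial.aeval fun τ => (-1 : H) ^ RTree.size τ * tree τ

/-- The convolution product `μ ∘ (f ⊗ g) ∘ Δ` of multiplicative maps. -/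
noncomputable def conv (f g : H →ₐ[ℝ] H) : H →ₐ[ℝ] H :=
  (Algebra.TensorProduct.productMap f g).comp coproduct

/-- The values on trees of the convolution square root `φ = Id^(1/2)` of the identity map, given
by `φ(τ) = (τ - ∑ φ(P_c(τ)) φ(R_c(τ))) / 2`, where `c` runs over the admissible cuts other than
the empty and the total cut. -/
noncomputable def sqrtIdTree (τ : RTree) : H :=
  (1 / 2 : ℝ) • (tree τ -
    ((RTree.properCuts τ).attach.map fun c =>
      (c.1.1.attach.map fun t => sqrtIdTree t.1).prod * sqrtIdTree c.1.2).sum)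
termination_by τ.size
decreasing_by
  · exact RTree.size_pruned_lt c.2 t.2
  · exact RTree.size_trunk_lt c.2

/-- The unique multiplicative map `Id^(1/2)` with `Id^(1/2) * Id^(1/2) = Id`
(convolution product). -/
noncomputable def sqrtId : H →ₐ[ℝ] H := MvPolynomial.aeval sqrtIdTree

/-- The map `τ ↦ τ⁻ = μ ∘ (S̄ ⊗ Id) ∘ Δ ∘ Id^(1/2)`, where `S̄ τ = (-1)^|τ| S τ`. -/
noncomputable def minus : H →ₐ[ℝ] H :=
  (conv (antipode.comp involution) (AlgHom.id ℝ H)).comp sqrtId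

/-- The map `τ ↦ τ⁺ = μ ∘ (Id ⊗ (·)⁻ ∘ S) ∘ Δ`. -/
noncomputable def plus : H →ₐ[ℝ] H :=
  conv (AlgHom.id ℝ H) (minus.comp antipode)

/-- The order of a character: the supremum of all `n` such that `ψ(τ) = 1 / τ!` for `|τ| ≤ n`. -/
noncomputable def order (ψ : H →ₐ[ℝ] ℝ) : ℕ∞ :=
  sSup {N : ℕ∞ | ∃ n : ℕ, N = n ∧
    ∀ τ : RTree, τ.size ≤ n → ψ (tree τ) = 1 / (τ.factorial : ℝ)}

/-- The antisymmetric order of a character: the supremum of all `n` such that `ψ(τ⁺) = 0` for all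
non-empty trees `τ` with `|τ| ≤ n`. -/
noncomputable def antisymmetricOrder (ψ : H →ₐ[ℝ] ℝ) : ℕ∞ :=
  sSup {N : ℕ∞ | ∃ n : ℕ, N = n ∧ ∀ τ : RTree, τ.size ≤ n → ψ (plus (tree τ)) = 0}

/-! ### Runge-Kutta schemes -/

/-- An `s`-stage Runge-Kutta scheme, given by its matrix and its weights. -/
@[ext]
structure RKScheme (s : ℕ) where
  A : Matrix (Fin s) (Fin s) ℝ
  b : Fin s → ℝ

namespace RKScheme

variable {s : ℕ}

/-- The nodes `c_i = ∑_j a_ij`. -/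
def c (Ψ : RKScheme s) (i : Fin s) : ℝ := ∑ j, Ψ.A i j

/-- The scheme is explicit: its matrix is strictly lower triangular. -/
def IsExplicit (Ψ : RKScheme s) : Prop := ∀ i j : Fin s, i ≤ j → Ψ.A i j = 0

/-- The derivative weights: `(ψ_i D)([τ₁, …, τₖ]) = ∏ₗ ψ_i(τₗ)`, where the internal weights are
`ψ_i(τ) = ∑_j a_ij (ψ_j D)(τ)`. -/
noncomputable def derivativeWeight (Ψ : RKScheme s) : RTree → Fin s → ℝ :=
  RTree.fold fun F i => (F.map fun w => ∑ j, Ψ.A i j * w j).prod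

/-- The elementary weights `ψ(τ) = ∑_i b_i (ψ_i D)(τ)`, extended to a character of `H`. -/
noncomputable def character (Ψ : RKScheme s) : H →ₐ[ℝ] ℝ :=
  MvPolynomial.aeval fun τ => ∑ i, Ψ.b i * Ψ.derivativeWeight τ i

end RKScheme

/-- The `s`-stage members of the class `EES(n, m)`: explicit schemes of order exactly `n` and
antisymmetric order exactly `m`.  (For `n ≥ 1` the order condition on the one-vertex tree is the
consistency condition `∑ b_i = 1`.) -/
def EESClass (s n m : ℕ) : Set (RKScheme s) :=
  {Ψ | Ψ.IsExplicit ∧ order Ψ.character = n ∧ antisymmetricOrder Ψ.character = m}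

/-- The scheme `EES(2,5;x)`. -/
noncomputable def EES25 (x : ℝ) : RKScheme 3 where
  A := !![0, 0, 0;
          (1 + 2 * x) / (4 * (1 - x)), 0, 0;
          (4 * x - 1) ^ 2 / (4 * (x - 1) * (1 - 4 * x ^ 2)), (1 - x) / (1 - 4 * x ^ 2), 0]
  b := ![x, 1 / 2, 1 / 2 - x]

end EES

namespace EES

/-! Characters of `H` form a group under convolution, the inverse of `f` being `f.comp antipode`,
and agreement up to a given number of vertices is compatible with this group structure. Let ψ be a
character, ψ̄ its composite with `involution` (numerically, the step of size -h), and χ its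
composite with `minus`. Then χ * χ = ψ̄⁻¹ * ψ, and ψ composed with `plus` is ψ * χ⁻¹. Square roots
are unique, so up to any size ψ vanishes on the τ⁺ iff ψ = χ, iff ψ * ψ = ψ̄⁻¹ * ψ, iff η = ψ̄ * ψ
is trivial. This is `comp_plus_agree_iff`; η is `symmetryDefect`.

Since ψ * η = η̄ * ψ, triviality of η up to an even size extends to the next odd size
(`agreeUpTo_symmetryDefect_succ`). So only even sizes impose conditions. Size 2 follows from order
two, and the four trees of size 4 give four polynomial equations in the coefficients of an explicit
three-stage scheme, computed by the root recursion `stageDefect_node`. Together with order two,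
three of them force c = a + 1/2, b₂ = 1/2 and 4(1 - b₁)a = 1 + 2b₁, which is the family with x = b₁;
the fourth then holds on it.

Both orders are exact because b₃a₃₂a₂₁ = 1/8. The path on three vertices would need 1/6, and the
stability polynomial R(z) = 1 + z + z²/2 + z³/8 satisfies R(-z)R(z) = 1 - z⁶/64, so the path on six
vertices has nonzero defect. -/

/-! ### Sums over cuts of a forest -/

/-- Distributivity: expanding a product of sums means choosing one summand in each factor. It turns
sums over independent choices at the children of a root into products over the children. -/
theorem sum_map_sections {α β M : Type*} [CommSemiring M] (g : α → M) (L : β → Multiset α)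
    (F : Multiset β) :
    (((F.map L).Sections).map fun ch => (ch.map g).prod).sum =
      (F.map fun t => ((L t).map g).sum).prod := by
  induction F using Multiset.induction_on with
  | empty => simp
  | cons t F ih =>
    simp only [Multiset.map_cons, Multiset.sections_cons, Multiset.prod_cons, ← ih,
      Multiset.map_bind, Multiset.sum_bind, Multiset.map_map, Function.comp_def,
      Multiset.sum_map_mul_left, Multiset.sum_map_mul_right]

theorem map_sum_of_add {A M : Type*} [AddCommMonoid A] [CommMonoid M] (g : A → M) (h0 : g 0 = 1)
    (hadd : ∀ x y, g (x + y) = g x * g y) (s : Multiset A) : g s.sum = (s.map g).prod := by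
  induction s using Multiset.induction_on with
  | empty => simp [h0]
  | cons a s ih => simp [hadd, ih]

namespace RTree

/-- The cuts of the forest of children of a root: for each child, either remove it as a whole or
choose an admissible cut of it. -/
def forestCuts (F : Forest) : Multiset (Forest × Forest) :=
  (Multiset.Sections (F.map fun t =>
    (({t}, 0) : Forest × Forest) ::ₘ (admissibleCuts t).map fun c => (c.1, {c.2}))).map
      Multiset.sum

theorem fst_sum {A B : Type*} [AddCommMonoid A] [AddCommMonoid B] (s : Multiset (A × B)) :
    s.sum.1 = (s.map Prod.fst).sum :=
  map_multiset_sum (AddMonoidHom.fst A B) s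

theorem snd_sum {A B : Type*} [AddCommMonoid A] [AddCommMonoid B] (s : Multiset (A × B)) :
    s.sum.2 = (s.map Prod.snd).sum :=
  map_multiset_sum (AddMonoidHom.snd A B) s

theorem admissibleCuts_node (F : Forest) :
    admissibleCuts (node F) = (forestCuts F).map fun c => (c.1, node c.2) := by
  rw [admissibleCuts, para_node, forestCuts]
  simp only [Multiset.map_map, Function.comp_def, fst_sum, snd_sum]
  rfl

theorem forestCuts_zero : forestCuts 0 = {0} := by simp [forestCuts]

theorem forestCuts_cons (t : RTree) (F : Forest) :
    forestCuts (t ::ₘ F) =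
      ((({t}, 0) : Forest × Forest) ::ₘ (admissibleCuts t).map fun c => (c.1, {c.2})).bind
        fun x => (forestCuts F).map (x + ·) := by
  simp only [forestCuts, Multiset.map_cons, Multiset.sections_cons, Multiset.map_bind,
    Multiset.map_map, Function.comp_def, Multiset.sum_cons]

/-- A cut of a forest is an independent choice for each tree, and `g` is multiplicative, so the sum
factors. Both the coproduct of a forest and the stage recursion for the defect come from this. -/
theorem sum_map_forestCuts {M : Type*} [CommSemiring M] (g : Forest × Forest → M) (h0 : g 0 = 1)
    (hadd : ∀ x y, g (x + y) = g x * g y) (F : Forest) :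
    ((forestCuts F).map g).sum =
      (F.map fun t => g ({t}, 0) + ((admissibleCuts t).map fun c => g (c.1, {c.2})).sum).prod := by
  rw [forestCuts, Multiset.map_map]
  simp only [Function.comp_def, map_sum_of_add g h0 hadd]
  rw [sum_map_sections]
  simp [Multiset.map_map]

/-- The empty cut occurs with multiplicity exactly one, so the filter defining `properCuts` discards
a single summand. -/
theorem exists_admissibleCuts_eq_cons (τ : RTree) :
    ∃ s : Multiset (Forest × RTree), admissibleCuts τ = (0, τ) ::ₘ s ∧ ∀ c ∈ s, c.1 ≠ 0 := by
  induction τ using node_induction with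
  | h F ih =>
    suffices H : ∃ s : Multiset (Forest × Forest),
        forestCuts F = (0, F) ::ₘ s ∧ ∀ c ∈ s, c.1 ≠ 0 by
      obtain ⟨s, hs, h0⟩ := H
      refine ⟨s.map fun c => (c.1, node c.2), ?_, ?_⟩
      · rw [admissibleCuts_node, hs, Multiset.map_cons]
      · intro c hc
        obtain ⟨d, hd, rfl⟩ := Multiset.mem_map.1 hc
        exact h0 d hd
    induction F using Multiset.induction_on with
    | empty => exact ⟨0, by rw [forestCuts_zero]; rfl, by simp⟩
    | cons t F ihF =>
      obtain ⟨r, hr, hr0⟩ := ih t (Multiset.mem_cons_self t F)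
      obtain ⟨s, hs, hs0⟩ := ihF fun t ht => ih t (Multiset.mem_cons_of_mem ht)
      -- The nonempty cuts of `t ::ₘ F`: `t` untouched and a nonempty cut of `F`; `t` pruned as a
      -- whole; a nonempty cut inside `t`. In the last two cases the cut of `F` is arbitrary.
      refine ⟨s.map (((0, {t}) : Forest × Forest) + ·) +
        ((forestCuts F).map ((({t}, 0) : Forest × Forest) + ·) +
          (r.map fun c => ((c.1, {c.2}) : Forest × Forest)).bind
            fun x => (forestCuts F).map (x + ·)), ?_, ?_⟩
      · rw [forestCuts_cons, hr, Multiset.map_cons, Multiset.cons_bind, Multiset.cons_bind]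
        rw [show (forestCuts F).map (((0, {t}) : Forest × Forest) + ·) =
          (0, t ::ₘ F) ::ₘ s.map (((0, {t}) : Forest × Forest) + ·) by
            rw [hs, Multiset.map_cons]; simp]
        rw [← Multiset.cons_add]
        exact add_left_comm _ _ _
      · intro c hc
        simp only [Multiset.mem_add, Multiset.mem_map, Multiset.mem_bind] at hc
        rcases hc with ⟨d, hd, rfl⟩ | ⟨d, -, rfl⟩ | ⟨x, ⟨d, hd, rfl⟩, e, -, rfl⟩
        · simpa using hs0 d hd
        · simp
        · have := hr0 d hd
          simp [this]

theorem admissibleCuts_eq_cons (τ : RTree) : admissibleCuts τ = (0, τ) ::ₘ properCuts τ := by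
  classical
  obtain ⟨s, hs, h0⟩ := exists_admissibleCuts_eq_cons τ
  have : properCuts τ = s := by
    rw [properCuts, hs, Multiset.filter_cons_of_neg _ (by simp)]
    exact Multiset.filter_eq_self.2 h0
  rw [this, hs]

/-- The sets of edges of the trees of a forest of children of a root, together with choices of
edges to the root. -/
def forestEdgeCuts (F : Forest) : Multiset (ℕ × Forest × Forest) :=
  (Multiset.Sections (F.map fun t =>
    ((edgeCuts t).map fun c => ((c.1, {c.2.1}, c.2.2) : ℕ × Forest × Forest)) +
      (edgeCuts t).map fun c => (c.1 + 1, 0, c.2.1 ::ₘ c.2.2))).map Multiset.sum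

theorem edgeCuts_node (F : Forest) :
    edgeCuts (node F) = (forestEdgeCuts F).map fun c => (c.1, node c.2.1, c.2.2) := by
  rw [edgeCuts, para_node, forestEdgeCuts]
  simp only [Multiset.map_map, Function.comp_def, fst_sum, snd_sum]
  rfl

theorem sum_map_forestEdgeCuts {M : Type*} [CommSemiring M] (g : ℕ × Forest × Forest → M)
    (h0 : g 0 = 1) (hadd : ∀ x y, g (x + y) = g x * g y) (F : Forest) :
    ((forestEdgeCuts F).map g).sum =
      (F.map fun t => ((edgeCuts t).map fun c => g (c.1, {c.2.1}, c.2.2)).sum +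
        ((edgeCuts t).map fun c => g (c.1 + 1, 0, c.2.1 ::ₘ c.2.2)).sum).prod := by
  rw [forestEdgeCuts, Multiset.map_map]
  simp only [Function.comp_def, map_sum_of_add g h0 hadd]
  rw [sum_map_sections]
  simp [Multiset.map_map]

end RTree

/-! ### Forests as a basis, grafting and coassociativity -/

theorem forest_zero : forest 0 = 1 := by simp [forest]

theorem forest_singleton (t : RTree) : forest {t} = tree t := by simp [forest]

theorem forest_cons (t : RTree) (F : Forest) : forest (t ::ₘ F) = tree t * forest F := by
  simp [forest]

theorem forest_add (F G : Forest) : forest (F + G) = forest F * forest G := by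
  simp [forest]

theorem map_forest {C : Type*} [CommSemiring C] [Algebra ℝ C] (f : H →ₐ[ℝ] C) (F : Forest) :
    f (forest F) = (F.map fun t => f (tree t)).prod := by
  rw [forest, map_multiset_prod, Multiset.map_map]
  rfl

theorem map_forest_congr {C : Type*} [CommSemiring C] [Algebra ℝ C] {f g : H →ₐ[ℝ] C}
    {F : Forest} (h : ∀ t ∈ F, f (tree t) = g (tree t)) : f (forest F) = g (forest F) := by
  rw [map_forest, map_forest, Multiset.map_congr rfl h]

theorem forest_eq_monomial (m : RTree →₀ ℕ) :
    forest (Finsupp.toMultiset m) = MvPolynomial.monomial m 1 := by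
  rw [forest, Finsupp.toMultiset_map, Finsupp.prod_toMultiset, MvPolynomial.monomial_eq,
    Finsupp.prod_mapDomain_index (by simp) (by simp [pow_add])]
  simp

theorem forest_linearMap_ext {V : Type*} [AddCommMonoid V] [Module ℝ V] {f g : H →ₗ[ℝ] V}
    (h : ∀ F : Forest, f (forest F) = g (forest F)) : f = g := by
  refine (MvPolynomial.basisMonomials RTree ℝ).ext fun m => ?_
  rw [MvPolynomial.coe_basisMonomials]
  dsimp only
  rw [← forest_eq_monomial]
  exact h _

/-- The grafting operator: the linear map with `τ₁ ⋯ τₖ ↦ [τ₁, …, τₖ]`. -/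
noncomputable def bplus : H →ₗ[ℝ] H :=
  (MvPolynomial.basisMonomials RTree ℝ).constr ℝ fun m => tree (RTree.node (Finsupp.toMultiset m))

theorem bplus_forest (F : Forest) : bplus (forest F) = tree (RTree.node F) := by
  classical
  obtain ⟨m, rfl⟩ := (Multiset.toFinsupp (α := RTree)).symm.surjective F
  have h := (MvPolynomial.basisMonomials RTree ℝ).constr_basis ℝ
    (fun m => (tree (RTree.node (Finsupp.toMultiset m)) : H)) m
  rw [MvPolynomial.coe_basisMonomials] at h
  dsimp only at h
  rwa [← forest_eq_monomial] at h

/-- The part of the coproduct of a tree other than the total cut. -/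
noncomputable def cutSum (τ : RTree) : H ⊗[ℝ] H :=
  ((RTree.admissibleCuts τ).map fun c => forest c.1 ⊗ₜ[ℝ] tree c.2).sum

theorem coproduct_tree (τ : RTree) :
    coproduct (tree τ) = tree τ ⊗ₜ[ℝ] (1 : H) + cutSum τ :=
  MvPolynomial.aeval_X _ _

theorem coproduct_forest (F : Forest) :
    coproduct (forest F) =
      ((RTree.forestCuts F).map fun c => forest c.1 ⊗ₜ[ℝ] forest c.2).sum := by
  rw [map_forest, RTree.sum_map_forestCuts (fun c => forest c.1 ⊗ₜ[ℝ] forest c.2)]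
  · simp only [coproduct_tree, cutSum, forest_singleton, forest_zero]
  · simp [forest_zero, Algebra.TensorProduct.one_def]
  · simp [forest_add]

theorem cutSum_node (F : Forest) :
    cutSum (RTree.node F) = bplus.lTensor H (coproduct (forest F)) := by
  rw [coproduct_forest, map_multiset_sum, Multiset.map_map, cutSum, RTree.admissibleCuts_node,
    Multiset.map_map]
  simp [Function.comp_def, bplus_forest]

/-- The Hochschild cocycle property of grafting: a cut of a grafted tree is either total or a cut of
the forest below the root. It is the recursion behind coassociativity. -/
theorem coproduct_bplus (y : H) :
    coproduct (bplus y) = bplus y ⊗ₜ[ℝ] (1 : H) + bplus.lTensor H (coproduct y) := by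
  suffices h : coproduct.toLinearMap ∘ₗ bplus =
      (TensorProduct.mk ℝ H H).flip 1 ∘ₗ bplus + bplus.lTensor H ∘ₗ coproduct.toLinearMap from
    LinearMap.congr_fun h y
  refine forest_linearMap_ext fun F => ?_
  simp [bplus_forest, coproduct_tree, cutSum_node]

theorem algHom_ext_tree {C : Type*} [CommSemiring C] [Algebra ℝ C] {f g : H →ₐ[ℝ] C}
    (h : ∀ τ, f (tree τ) = g (tree τ)) : f = g :=
  MvPolynomial.algHom_ext h

theorem coproduct_coassoc :
    ((Algebra.TensorProduct.assoc ℝ ℝ ℝ H H H).toAlgHom.comp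
      (Algebra.TensorProduct.map coproduct (AlgHom.id ℝ H))).comp coproduct =
    (Algebra.TensorProduct.map (AlgHom.id ℝ H) coproduct).comp coproduct := by
  refine algHom_ext_tree (C := H ⊗[ℝ] (H ⊗[ℝ] H)) fun τ => ?_
  induction τ using RTree.node_induction with
  | h F ih =>
    -- Both sides are multiplicative, so agreement on the children gives agreement on their forest;
    -- the cocycle property then carries it to the grafted tree.
    have hF : (((Algebra.TensorProduct.assoc ℝ ℝ ℝ H H H).toAlgHom.comp
        (Algebra.TensorProduct.map coproduct (AlgHom.id ℝ H))).comp coproduct) (forest F) =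
        ((Algebra.TensorProduct.map (AlgHom.id ℝ H) coproduct).comp coproduct) (forest F) :=
      map_forest_congr (C := H ⊗[ℝ] (H ⊗[ℝ] H)) ih
    rw [← bplus_forest]
    simp only [AlgHom.comp_apply, coproduct_bplus, map_add] at hF ⊢
    have h1 : ∀ z : H ⊗[ℝ] H, (Algebra.TensorProduct.assoc ℝ ℝ ℝ H H H).toAlgHom
        (Algebra.TensorProduct.map coproduct (AlgHom.id ℝ H) (bplus.lTensor H z)) =
        (bplus.lTensor H).lTensor H ((Algebra.TensorProduct.assoc ℝ ℝ ℝ H H H).toAlgHom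
          (Algebra.TensorProduct.map coproduct (AlgHom.id ℝ H) z)) := by
      intro z
      induction z using TensorProduct.induction_on with
      | zero => simp
      | add x y hx hy => simp only [map_add, hx, hy]
      | tmul x y =>
        simp only [LinearMap.lTensor_tmul, Algebra.TensorProduct.map_tmul, AlgHom.id_apply]
        generalize coproduct x = w
        induction w using TensorProduct.induction_on with
        | zero => simp
        | add x y hx hy => simp only [map_add, hx, hy, TensorProduct.add_tmul]
        | tmul u v => simp
    have h2 : ∀ z : H ⊗[ℝ] H, Algebra.TensorProduct.map (AlgHom.id ℝ H) coproduct
        (bplus.lTensor H z) =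
        (Algebra.TensorProduct.assoc ℝ ℝ ℝ H H H).toAlgHom (bplus.lTensor H z ⊗ₜ[ℝ] (1 : H)) +
        (bplus.lTensor H).lTensor H
          (Algebra.TensorProduct.map (AlgHom.id ℝ H) coproduct z) := by
      intro z
      induction z using TensorProduct.induction_on with
      | zero => simp
      | add x y hx hy =>
        simp only [map_add, hx, hy, TensorProduct.add_tmul]
        abel
      | tmul x y => simp [coproduct_bplus, TensorProduct.tmul_add]
    rw [h1, h2, hF]
    simp [coproduct_bplus, TensorProduct.add_tmul, Algebra.TensorProduct.one_def]
    abel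

/-! ### The convolution product of characters -/

theorem sum_properCuts_eq_zero {C : Type*} [AddCommMonoid C] {h : Forest × RTree → C} (τ : RTree)
    (h0 : ∀ c ∈ RTree.properCuts τ, h c = 0) : ((RTree.properCuts τ).map h).sum = 0 := by
  rw [Multiset.map_congr rfl h0]
  simp

section Convolution

variable {C : Type*} [CommSemiring C] [Algebra ℝ C]

/-- The convolution product of characters with values in a commutative algebra. -/
noncomputable def convolution (f g : H →ₐ[ℝ] C) : H →ₐ[ℝ] C :=
  (Algebra.TensorProduct.productMap f g).comp coproduct

/-- The unit of the convolution product. -/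
noncomputable def convUnit (C : Type*) [CommSemiring C] [Algebra ℝ C] : H →ₐ[ℝ] C :=
  MvPolynomial.aeval fun _ => 0

theorem convUnit_tree (τ : RTree) : convUnit C (tree τ) = 0 := MvPolynomial.aeval_X _ _

theorem convUnit_forest {F : Forest} (hF : F ≠ 0) : convUnit C (forest F) = 0 := by
  obtain ⟨t, ht⟩ := Multiset.exists_mem_of_ne_zero hF
  obtain ⟨G, rfl⟩ := Multiset.exists_cons_of_mem ht
  rw [forest_cons, map_mul, convUnit_tree, zero_mul]

theorem convolution_tree (f g : H →ₐ[ℝ] C) (τ : RTree) :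
    convolution f g (tree τ) = f (tree τ) +
      ((RTree.admissibleCuts τ).map fun c => f (forest c.1) * g (tree c.2)).sum := by
  rw [convolution, AlgHom.comp_apply, coproduct_tree, map_add, cutSum, map_multiset_sum,
    Multiset.map_map]
  simp [Function.comp_def]

theorem convolution_tree_proper (f g : H →ₐ[ℝ] C) (τ : RTree) :
    convolution f g (tree τ) = f (tree τ) + (g (tree τ) +
      ((RTree.properCuts τ).map fun c => f (forest c.1) * g (tree c.2)).sum) := by
  rw [convolution_tree, RTree.admissibleCuts_eq_cons, Multiset.map_cons, Multiset.sum_cons,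
    forest_zero, map_one, one_mul]

theorem ne_zero_of_mem_properCuts {τ : RTree} {c : Forest × RTree}
    (hc : c ∈ RTree.properCuts τ) : c.1 ≠ 0 := by
  classical
  exact (Multiset.mem_filter.1 hc).2

theorem convUnit_convolution (f : H →ₐ[ℝ] C) : convolution (convUnit C) f = f := by
  refine algHom_ext_tree fun τ => ?_
  rw [convolution_tree_proper, convUnit_tree, sum_properCuts_eq_zero τ, zero_add, add_zero]
  intro c hc
  rw [convUnit_forest (ne_zero_of_mem_properCuts hc), zero_mul]

theorem convolution_convUnit (f : H →ₐ[ℝ] C) : convolution f (convUnit C) = f := by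
  refine algHom_ext_tree fun τ => ?_
  simp [convolution_tree, convUnit_tree]

theorem convolution_assoc (f g h : H →ₐ[ℝ] C) :
    convolution (convolution f g) h = convolution f (convolution g h) := by
  have h1 : convolution (convolution f g) h = (Algebra.TensorProduct.productMap f
      (Algebra.TensorProduct.productMap g h)).comp
      (((Algebra.TensorProduct.assoc ℝ ℝ ℝ H H H).toAlgHom.comp
      (Algebra.TensorProduct.map coproduct (AlgHom.id ℝ H))).comp coproduct) := by
    rw [convolution, ← AlgHom.comp_assoc]
    congr 1
    refine Algebra.TensorProduct.ext' fun x y => ?_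
    simp only [convolution, Algebra.TensorProduct.productMap_apply_tmul, AlgHom.comp_apply,
      Algebra.TensorProduct.map_tmul, AlgHom.id_apply]
    generalize coproduct x = w
    induction w using TensorProduct.induction_on with
    | zero => simp
    | add x y hx hy => simp only [map_add, hx, hy, TensorProduct.add_tmul, add_mul]
    | tmul u v => simp [mul_assoc]
  rw [h1, coproduct_coassoc, ← AlgHom.comp_assoc, convolution]
  congr 1
  refine Algebra.TensorProduct.ext' fun x y => ?_
  simp [convolution]

theorem comp_convolution {D : Type*} [CommSemiring D] [Algebra ℝ D] (k : C →ₐ[ℝ] D)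
    (f g : H →ₐ[ℝ] C) : k.comp (convolution f g) = convolution (k.comp f) (k.comp g) := by
  rw [convolution, convolution, ← AlgHom.comp_assoc]
  congr 1
  refine Algebra.TensorProduct.ext' fun x y => ?_
  simp

theorem comp_convUnit {D : Type*} [CommSemiring D] [Algebra ℝ D] (k : C →ₐ[ℝ] D) :
    k.comp (convUnit C) = convUnit D := by
  refine algHom_ext_tree fun τ => ?_
  simp [convUnit]

end Convolution

theorem conv_eq_convolution (f g : H →ₐ[ℝ] H) : conv f g = convolution f g := rfl

/-! ### The antipode -/

/-- The sum over all sets of edges of a tree, with the component of the root kept apart. -/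
noncomputable def edgeCutSum (τ : RTree) : H ⊗[ℝ] H :=
  ((RTree.edgeCuts τ).map fun c => ((-1 : H) ^ c.1 * forest c.2.2) ⊗ₜ[ℝ] tree c.2.1).sum

theorem antipode_tree (τ : RTree) :
    antipode (tree τ) =
      ((RTree.edgeCuts τ).map fun c => (-1 : H) ^ (c.1 + 1) * (tree c.2.1 * forest c.2.2)).sum :=
  MvPolynomial.aeval_X _ _

theorem antipode_tree_eq_neg (τ : RTree) :
    antipode (tree τ) = -Algebra.TensorProduct.productMap (AlgHom.id ℝ H) (AlgHom.id ℝ H)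
      (edgeCutSum τ) := by
  rw [antipode_tree, edgeCutSum, map_multiset_sum, Multiset.map_map, ← Multiset.sum_map_neg]
  refine congrArg _ (Multiset.map_congr rfl fun c _ => ?_)
  simp
  ring

/-- For each child, a kept edge contributes `edgeCutSum t`. A removed edge detaches all components
of `t` and adds one sign, which is exactly the exponent |c| + 1 in the antipode. -/
theorem edgeCutSum_node (F : Forest) :
    edgeCutSum (RTree.node F) = bplus.lTensor H
      (F.map fun t => antipode (tree t) ⊗ₜ[ℝ] (1 : H) + edgeCutSum t).prod := by
  have h := RTree.sum_map_forestEdgeCuts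
    (fun c => ((-1 : H) ^ c.1 * forest c.2.2) ⊗ₜ[ℝ] forest c.2.1)
    (by simp [forest_zero, Algebra.TensorProduct.one_def])
    (fun x y => by
      simp only [Prod.fst_add, Prod.snd_add, forest_add, Algebra.TensorProduct.tmul_mul_tmul,
        pow_add]
      congr 1
      ring) F
  have h' : (F.map fun t => antipode (tree t) ⊗ₜ[ℝ] (1 : H) + edgeCutSum t).prod =
      ((RTree.forestEdgeCuts F).map
        fun c => ((-1 : H) ^ c.1 * forest c.2.2) ⊗ₜ[ℝ] forest c.2.1).sum := by
    rw [h]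
    refine congrArg _ (Multiset.map_congr rfl fun t _ => ?_)
    rw [add_comm, edgeCutSum, antipode_tree]
    simp only [forest_singleton, forest_zero, forest_cons]
    congr 1
    rw [← Algebra.TensorProduct.includeLeft_apply (S := ℝ), map_multiset_sum, Multiset.map_map]
    rfl
  rw [h', edgeCutSum, RTree.edgeCuts_node, map_multiset_sum, Multiset.map_map, Multiset.map_map]
  simp [Function.comp_def, bplus_forest]

/-- In any set of edges, those met first on the way up from the root form an admissible cut; the
remaining edges lie in the pruned trees, where they sum to the antipode. Formally, both sides obey
the same recursion through the root. -/
theorem edgeCutSum_eq (τ : RTree) :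
    edgeCutSum τ = Algebra.TensorProduct.map antipode (AlgHom.id ℝ H) (cutSum τ) := by
  induction τ using RTree.node_induction with
  | h F ih =>
    have h1 : (F.map fun t => antipode (tree t) ⊗ₜ[ℝ] (1 : H) + edgeCutSum t).prod =
        Algebra.TensorProduct.map antipode (AlgHom.id ℝ H) (coproduct (forest F)) := by
      rw [← AlgHom.comp_apply, map_forest]
      refine congrArg _ (Multiset.map_congr rfl fun t ht => ?_)
      simp [coproduct_tree, ih t ht]
    rw [edgeCutSum_node, h1, cutSum_node]
    generalize coproduct (forest F) = w
    induction w using TensorProduct.induction_on with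
    | zero => simp
    | add x y hx hy => simp only [map_add, hx, hy]
    | tmul u v => simp

theorem antipode_convolution_id : convolution antipode (AlgHom.id ℝ H) = convUnit H := by
  refine algHom_ext_tree fun τ => ?_
  rw [convUnit_tree, convolution, AlgHom.comp_apply, coproduct_tree, map_add,
    Algebra.TensorProduct.productMap_apply_tmul, map_one, mul_one, antipode_tree_eq_neg,
    edgeCutSum_eq, neg_add_eq_zero]
  generalize cutSum τ = w
  induction w using TensorProduct.induction_on with
  | zero => simp
  | add x y hx hy => simp only [map_add, hx, hy]
  | tmul u v => simp

section Antipode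

variable {C : Type*} [CommSemiring C] [Algebra ℝ C]

theorem comp_antipode_convolution (f : H →ₐ[ℝ] C) :
    convolution (f.comp antipode) f = convUnit C := by
  conv_lhs => rw [← AlgHom.comp_id f, AlgHom.comp_assoc, AlgHom.id_comp]
  rw [← comp_convolution, antipode_convolution_id, comp_convUnit]

/-- A left inverse that itself has a left inverse is two-sided: the left inverse `(f.comp
antipode).comp antipode` of `f.comp antipode` must be `f`. -/
theorem convolution_comp_antipode (f : H →ₐ[ℝ] C) :
    convolution f (f.comp antipode) = convUnit C := by
  have h := comp_antipode_convolution (f.comp antipode)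
  have h' : (f.comp antipode).comp antipode = f := by
    rw [← convolution_convUnit ((f.comp antipode).comp antipode), ← comp_antipode_convolution f,
      ← convolution_assoc, h, convUnit_convolution]
  rwa [h'] at h

end Antipode

/-! ### The convolution square root of the identity -/

theorem sqrtId_convolution_sqrtId : convolution sqrtId sqrtId = AlgHom.id ℝ H := by
  refine algHom_ext_tree fun τ => ?_
  have h1 : ∀ t, sqrtId (tree t) = sqrtIdTree t := fun t => MvPolynomial.aeval_X _ _
  have h2 : ((RTree.properCuts τ).attach.map fun c =>
      (c.1.1.attach.map fun t => sqrtIdTree t.1).prod * sqrtIdTree c.1.2).sum =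
      ((RTree.properCuts τ).map fun c => sqrtId (forest c.1) * sqrtId (tree c.2)).sum := by
    rw [← Multiset.attach_map_val' (RTree.properCuts τ)
      fun c => sqrtId (forest c.1) * sqrtId (tree c.2)]
    refine congrArg _ (Multiset.map_congr rfl fun c _ => ?_)
    rw [Multiset.attach_map_val' c.1.1 sqrtIdTree, map_forest]
    simp only [h1]
  have h3 := sqrtIdTree.eq_1 τ
  rw [h2, ← h1] at h3
  rw [convolution_tree_proper, ← add_assoc]
  have h4 : sqrtId (tree τ) + sqrtId (tree τ) = (2 : ℝ) • sqrtId (tree τ) := by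
    rw [two_smul]
  rw [h4]
  nth_rw 1 [h3]
  rw [smul_smul]
  norm_num

/-! ### The canonical involution -/

theorem involution_tree (τ : RTree) : involution (tree τ) = (-1 : H) ^ RTree.size τ * tree τ :=
  MvPolynomial.aeval_X _ _

theorem involution_forest (F : Forest) :
    involution (forest F) = (-1 : H) ^ (F.map RTree.size).sum * forest F := by
  induction F using Multiset.induction_on with
  | empty => simp [forest_zero]
  | cons t F ih =>
    rw [forest_cons, map_mul, ih, involution_tree, Multiset.map_cons, Multiset.sum_cons, pow_add]
    ring

section Involution

variable {C : Type*} [CommRing C] [Algebra ℝ C]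

theorem comp_involution_tree (f : H →ₐ[ℝ] C) (τ : RTree) :
    f.comp involution (tree τ) = (-1 : C) ^ RTree.size τ * f (tree τ) := by
  simp [involution_tree]

/-- Admissible cuts preserve the number of vertices, so the sign distributes over pruned forest and
trunk. -/
theorem convolution_comp_involution (f g : H →ₐ[ℝ] C) :
    (convolution f g).comp involution =
      convolution (f.comp involution) (g.comp involution) := by
  refine algHom_ext_tree fun τ => ?_
  rw [comp_involution_tree, convolution_tree, convolution_tree, comp_involution_tree, mul_add,
    ← Multiset.sum_map_mul_left]
  congr 2
  refine Multiset.map_congr rfl fun c hc => ?_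
  rw [AlgHom.comp_apply, involution_forest, comp_involution_tree,
    ← RTree.size_of_mem_admissibleCuts τ c hc, map_mul, pow_add, map_pow, map_neg, map_one]
  ring

theorem convUnit_comp_involution : (convUnit C).comp involution = convUnit C := by
  refine algHom_ext_tree fun τ => ?_
  rw [comp_involution_tree, convUnit_tree, mul_zero]

theorem comp_involution_comp_involution (f : H →ₐ[ℝ] C) :
    (f.comp involution).comp involution = f := by
  refine algHom_ext_tree fun τ => ?_
  rw [comp_involution_tree, comp_involution_tree, ← mul_assoc, ← mul_pow]
  simp

end Involution

/-! ### Agreement of characters up to a given size -/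

section AgreeUpTo

variable {C : Type*} [CommRing C] [Algebra ℝ C]

/-- The characters `f` and `g` agree on all trees with at most `n` vertices. -/
def AgreeUpTo (n : ℕ) (f g : H →ₐ[ℝ] C) : Prop :=
  ∀ τ : RTree, τ.size ≤ n → f (tree τ) = g (tree τ)

namespace AgreeUpTo

variable {n m : ℕ} {f f' g g' : H →ₐ[ℝ] C}

theorem refl (n : ℕ) (f : H →ₐ[ℝ] C) : AgreeUpTo n f f := fun _ _ => rfl

theorem mono (h : AgreeUpTo n f g) (hm : m ≤ n) : AgreeUpTo m f g :=
  fun τ hτ => h τ (hτ.trans hm)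

/-- Proper cuts produce only strictly smaller trees, so agreement up to `n` already controls the
mixed terms at size `n + 1`. -/
theorem sum_properCuts (hf : AgreeUpTo n f f') (hg : AgreeUpTo n g g') {τ : RTree}
    (hτ : τ.size ≤ n + 1) :
    ((RTree.properCuts τ).map fun c => f (forest c.1) * g (tree c.2)).sum =
      ((RTree.properCuts τ).map fun c => f' (forest c.1) * g' (tree c.2)).sum := by
  refine congrArg _ (Multiset.map_congr rfl fun c hc => ?_)
  rw [hg c.2 (Nat.lt_succ_iff.1 ((RTree.size_trunk_lt hc).trans_le hτ)),
    map_forest_congr fun t ht =>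
      hf t (Nat.lt_succ_iff.1 ((RTree.size_pruned_lt hc ht).trans_le hτ))]

theorem convolution (hf : AgreeUpTo n f f') (hg : AgreeUpTo n g g') :
    AgreeUpTo n (convolution f g) (convolution f' g') := fun τ hτ => by
  rw [convolution_tree_proper, convolution_tree_proper, hf τ hτ, hg τ hτ,
    sum_properCuts hf hg (hτ.trans n.le_succ)]

theorem convolution_left_iff (k : H →ₐ[ℝ] C) :
    AgreeUpTo n (EES.convolution k f) (EES.convolution k g) ↔ AgreeUpTo n f g := by
  refine ⟨fun h => ?_, (refl n k).convolution⟩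
  have := (refl n (k.comp antipode)).convolution h
  rwa [← convolution_assoc, ← convolution_assoc, comp_antipode_convolution, convUnit_convolution,
    convUnit_convolution] at this

theorem convolution_right_iff (k : H →ₐ[ℝ] C) :
    AgreeUpTo n (EES.convolution f k) (EES.convolution g k) ↔ AgreeUpTo n f g := by
  refine ⟨fun h => ?_, fun h => h.convolution (refl n k)⟩
  have := h.convolution (refl n (k.comp antipode))
  rwa [convolution_assoc, convolution_assoc, convolution_comp_antipode, convolution_convUnit,
    convolution_convUnit] at this

/-- Uniqueness of convolution square roots: once smaller trees agree, the squares differ at τ by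
twice the difference of the values. -/
theorem convolution_self_iff :
    AgreeUpTo n (EES.convolution f f) (EES.convolution g g) ↔ AgreeUpTo n f g := by
  refine ⟨fun h => ?_, fun h => h.convolution h⟩
  induction n with
  | zero => exact fun τ hτ => absurd hτ (RTree.size_pos τ).not_ge
  | succ n ih =>
    have hn := ih (h.mono n.le_succ)
    intro τ hτ
    have h1 := h τ hτ
    rw [convolution_tree_proper, convolution_tree_proper, sum_properCuts hn hn hτ, ← add_assoc,
      ← add_assoc, add_left_inj, ← two_smul ℝ, ← two_smul ℝ] at h1
    have h2 := congrArg ((1 / 2 : ℝ) • ·) h1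
    simpa [smul_smul] using h2

end AgreeUpTo

end AgreeUpTo

/-! ### The antisymmetric order in terms of the symmetry defect -/

/-- The convolution product of `ψ ∘ involution` and `ψ`. -/
noncomputable def symmetryDefect (ψ : H →ₐ[ℝ] ℝ) : H →ₐ[ℝ] ℝ :=
  convolution (ψ.comp involution) ψ

/-- With χ * χ = ω * ψ and ω inverse to ψ composed with `involution`, cancel χ⁻¹, square, cancel ψ
on the right, and multiply by ω⁻¹ on the left. -/
theorem comp_plus_agree_iff (ψ : H →ₐ[ℝ] ℝ) (n : ℕ) :
    AgreeUpTo n (ψ.comp plus) (convUnit ℝ) ↔ AgreeUpTo n (symmetryDefect ψ) (convUnit ℝ) := by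
  set χ : H →ₐ[ℝ] ℝ := ψ.comp minus with hχ
  set ω : H →ₐ[ℝ] ℝ := ψ.comp (antipode.comp involution) with hω
  have hplus : ψ.comp plus = convolution ψ (χ.comp antipode) := by
    rw [plus, conv_eq_convolution, comp_convolution]
    rfl
  have hsq : convolution χ χ = convolution ω ψ := by
    have h : χ = (convolution ω ψ).comp sqrtId := by
      rw [hχ, minus, conv_eq_convolution, ← AlgHom.comp_assoc, comp_convolution, AlgHom.comp_id]
    rw [h, ← comp_convolution, sqrtId_convolution_sqrtId, AlgHom.comp_id]
  have hunit : convolution (ψ.comp involution) ω = convUnit ℝ := by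
    rw [hω, ← AlgHom.comp_assoc, ← convolution_comp_involution, convolution_comp_antipode,
      convUnit_comp_involution]
  rw [hplus]
  nth_rw 1 [← convolution_comp_antipode χ]
  rw [AgreeUpTo.convolution_right_iff,
    ← AgreeUpTo.convolution_self_iff, hsq, AgreeUpTo.convolution_right_iff,
    ← AgreeUpTo.convolution_left_iff (ψ.comp involution), hunit]
  rfl

theorem symmetryDefect_comp_involution (ψ : H →ₐ[ℝ] ℝ) :
    (symmetryDefect ψ).comp involution = convolution ψ (ψ.comp involution) := by
  rw [symmetryDefect, convolution_comp_involution, comp_involution_comp_involution]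

/-- With η the defect, associativity gives ψ * η = η̄ * ψ. At size `n + 1` the mixed terms vanish,
which leaves η(τ) = (-1)^(n+1) η(τ) = -η(τ). -/
theorem agreeUpTo_symmetryDefect_succ {ψ : H →ₐ[ℝ] ℝ} {n : ℕ} (hn : Even n)
    (h : AgreeUpTo n (symmetryDefect ψ) (convUnit ℝ)) :
    AgreeUpTo (n + 1) (symmetryDefect ψ) (convUnit ℝ) := by
  intro τ hτ
  rcases hτ.lt_or_eq with hlt | heq
  · exact h τ (Nat.lt_succ_iff.1 hlt)
  have h' : AgreeUpTo n ((symmetryDefect ψ).comp involution) (convUnit ℝ) := fun t ht => by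
    rw [comp_involution_tree, h t ht, convUnit_tree, mul_zero]
  have key : convolution ψ (symmetryDefect ψ) =
      convolution ((symmetryDefect ψ).comp involution) ψ := by
    rw [symmetryDefect_comp_involution, symmetryDefect, convolution_assoc]
  have h1 := AlgHom.congr_fun key (tree τ)
  rw [convolution_tree_proper, convolution_tree_proper,
    (AgreeUpTo.refl n ψ).sum_properCuts h hτ, h'.sum_properCuts (AgreeUpTo.refl n ψ) hτ,
    sum_properCuts_eq_zero τ fun c _ => by rw [convUnit_tree, mul_zero],
    sum_properCuts_eq_zero τ fun c hc => by
      rw [convUnit_forest (ne_zero_of_mem_properCuts hc), zero_mul],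
    comp_involution_tree, heq, hn.add_one.neg_one_pow] at h1
  rw [convUnit_tree]
  linarith

/-! ### Orders as suprema -/

/-- The supremum of an initial segment of ℕ is its last element; `p 0` rules out the empty segment,
whose supremum is also 0. -/
theorem sSup_eq_natCast_iff {p : ℕ → Prop} (h0 : p 0) (hp : ∀ m n, m ≤ n → p n → p m) (k : ℕ) :
    sSup {N : ℕ∞ | ∃ n : ℕ, N = n ∧ p n} = k ↔ p k ∧ ¬p (k + 1) := by
  constructor
  · intro h
    have hnot : ¬p (k + 1) := fun hk => by
      have h1 : ((k + 1 : ℕ) : ℕ∞) ≤ sSup {N : ℕ∞ | ∃ n : ℕ, N = n ∧ p n} :=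
        le_sSup ⟨k + 1, rfl, hk⟩
      rw [h, Nat.cast_le] at h1
      omega
    refine ⟨?_, hnot⟩
    rcases Nat.eq_zero_or_pos k with rfl | hk
    · exact h0
    · by_contra hpk
      have h1 : sSup {N : ℕ∞ | ∃ n : ℕ, N = n ∧ p n} ≤ ((k - 1 : ℕ) : ℕ∞) := by
        refine sSup_le ?_
        rintro _ ⟨n, rfl, hn⟩
        rw [Nat.cast_le]
        by_contra hlt
        exact hpk (hp k n (by omega) hn)
      rw [h, Nat.cast_le] at h1
      omega
  · rintro ⟨hk, hk'⟩
    refine le_antisymm (sSup_le ?_) (le_sSup ⟨k, rfl, hk⟩)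
    rintro _ ⟨n, rfl, hn⟩
    rw [Nat.cast_le]
    by_contra hlt
    exact hk' (hp (k + 1) n (by omega) hn)

theorem order_eq_iff (ψ : H →ₐ[ℝ] ℝ) (k : ℕ) :
    order ψ = k ↔ (∀ τ : RTree, τ.size ≤ k → ψ (tree τ) = 1 / (τ.factorial : ℝ)) ∧
      ¬∀ τ : RTree, τ.size ≤ k + 1 → ψ (tree τ) = 1 / (τ.factorial : ℝ) :=
  sSup_eq_natCast_iff (fun τ hτ => absurd hτ (RTree.size_pos τ).not_ge)
    (fun _ _ hmn h τ hτ => h τ (hτ.trans hmn)) k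

theorem antisymmetricOrder_eq_iff (ψ : H →ₐ[ℝ] ℝ) (k : ℕ) :
    antisymmetricOrder ψ = k ↔ AgreeUpTo k (symmetryDefect ψ) (convUnit ℝ) ∧
      ¬AgreeUpTo (k + 1) (symmetryDefect ψ) (convUnit ℝ) := by
  rw [← comp_plus_agree_iff, ← comp_plus_agree_iff]
  simp only [AgreeUpTo, convUnit_tree, AlgHom.comp_apply]
  exact sSup_eq_natCast_iff (p := fun n => ∀ τ : RTree, τ.size ≤ n → ψ (plus (tree τ)) = 0)
    (fun τ hτ => absurd hτ (RTree.size_pos τ).not_ge)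
    (fun _ _ hmn h τ hτ => h τ (hτ.trans hmn)) k

/-! ### Small trees -/

namespace RTree

theorem exists_eq_node (τ : RTree) : ∃ F : Forest, τ = node F := by
  induction τ using node_induction with
  | h F _ => exact ⟨F, rfl⟩

theorem factorial_node (F : Forest) :
    factorial (node F) = size (node F) * (F.map factorial).prod := by
  rw [factorial, para_node]
  simp [Multiset.map_map]

/-- The tree on two vertices. -/
def chain2 : RTree := node {node 0}

/-- The path on three vertices, rooted at an end. -/
def chain3 : RTree := node {chain2}

/-- The tree on three vertices with two leaves. -/
def cherry : RTree := node {node 0, node 0}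

theorem size_node_zero : size (node 0) = 1 := by simp [size_node]

theorem size_chain2 : size chain2 = 2 := by simp [chain2, size_node]

theorem size_chain3 : size chain3 = 3 := by simp [chain3, chain2, size_node]

theorem size_cherry : size cherry = 3 := by simp [cherry, size_node]

theorem eq_zero_of_sum_size {F : Forest} (h : (F.map size).sum = 0) : F = 0 := by
  by_contra h0
  obtain ⟨t, ht⟩ := Multiset.exists_mem_of_ne_zero h0
  have := Multiset.single_le_sum (fun _ _ => Nat.zero_le _) _ (Multiset.mem_map_of_mem size ht)
  have := size_pos t
  omega

theorem exists_cons_of_sum_size {F : Forest} {n : ℕ} (h : (F.map size).sum = n + 1) :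
    ∃ t G, F = t ::ₘ G ∧ size t + (G.map size).sum = n + 1 ∧ 0 < size t := by
  have h0 : F ≠ 0 := by rintro rfl; simp at h
  obtain ⟨t, ht⟩ := Multiset.exists_mem_of_ne_zero h0
  obtain ⟨G, rfl⟩ := Multiset.exists_cons_of_mem ht
  exact ⟨t, G, rfl, by simpa using h, size_pos t⟩

theorem eq_of_size_eq_one {τ : RTree} (h : size τ = 1) : τ = node 0 := by
  obtain ⟨F, rfl⟩ := exists_eq_node τ
  rw [size_node] at h
  rw [eq_zero_of_sum_size (by omega : (F.map size).sum = 0)]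

theorem forest_eq_of_sum_size_eq_one {F : Forest} (h : (F.map size).sum = 1) : F = {node 0} := by
  obtain ⟨t, G, rfl, hs, hp⟩ := exists_cons_of_sum_size (n := 0) h
  rw [eq_of_size_eq_one (by omega : size t = 1), eq_zero_of_sum_size (by omega : (G.map size).sum = 0)]
  rfl

theorem eq_of_size_eq_two {τ : RTree} (h : size τ = 2) : τ = chain2 := by
  obtain ⟨F, rfl⟩ := exists_eq_node τ
  rw [size_node] at h
  rw [forest_eq_of_sum_size_eq_one (by omega : (F.map size).sum = 1), chain2]

theorem forest_eq_of_sum_size_eq_two {F : Forest} (h : (F.map size).sum = 2) :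
    F = {chain2} ∨ F = {node 0, node 0} := by
  obtain ⟨t, G, rfl, hs, hp⟩ := exists_cons_of_sum_size (n := 1) h
  obtain h1 | h2 : size t = 1 ∨ size t = 2 := by omega
  · right
    rw [eq_of_size_eq_one h1, forest_eq_of_sum_size_eq_one (by omega : (G.map size).sum = 1)]
    rfl
  · left
    rw [eq_of_size_eq_two h2, eq_zero_of_sum_size (by omega : (G.map size).sum = 0)]
    rfl

theorem eq_of_size_eq_three {τ : RTree} (h : size τ = 3) : τ = chain3 ∨ τ = cherry := by
  obtain ⟨F, rfl⟩ := exists_eq_node τ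
  rw [size_node] at h
  rcases forest_eq_of_sum_size_eq_two (F := F) (by omega) with rfl | rfl
  · exact Or.inl rfl
  · exact Or.inr rfl

theorem forest_eq_of_sum_size_eq_three {F : Forest} (h : (F.map size).sum = 3) :
    F = {chain3} ∨ F = {cherry} ∨ F = {node 0, chain2} ∨ F = {node 0, node 0, node 0} := by
  obtain ⟨t, G, rfl, hs, hp⟩ := exists_cons_of_sum_size (n := 2) h
  obtain h1 | h2 | h3 : size t = 1 ∨ size t = 2 ∨ size t = 3 := by omega
  · rw [eq_of_size_eq_one h1]
    rcases forest_eq_of_sum_size_eq_two (by omega : (G.map size).sum = 2) with rfl | rfl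
    · exact Or.inr (Or.inr (Or.inl rfl))
    · exact Or.inr (Or.inr (Or.inr rfl))
  · rw [eq_of_size_eq_two h2, forest_eq_of_sum_size_eq_one (by omega : (G.map size).sum = 1)]
    exact Or.inr (Or.inr (Or.inl (Multiset.cons_swap _ _ _)))
  · rw [eq_zero_of_sum_size (by omega : (G.map size).sum = 0)]
    rcases eq_of_size_eq_three h3 with rfl | rfl
    · exact Or.inl rfl
    · exact Or.inr (Or.inl rfl)

theorem eq_of_size_eq_four {τ : RTree} (h : size τ = 4) :
    τ = node {chain3} ∨ τ = node {cherry} ∨ τ = node {node 0, chain2} ∨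
      τ = node {node 0, node 0, node 0} := by
  obtain ⟨F, rfl⟩ := exists_eq_node τ
  rw [size_node] at h
  rcases forest_eq_of_sum_size_eq_three (F := F) (by omega) with rfl | rfl | rfl | rfl <;> simp

end RTree

theorem sum_map_mul_sum {α ι M : Type*} [Fintype ι] [CommSemiring M] (x : α → M) (y : ι → M)
    (z : α → ι → M) (m : Multiset α) :
    (m.map fun c => x c * ∑ j, y j * z c j).sum = ∑ j, y j * (m.map fun c => x c * z c j).sum := by
  induction m using Multiset.induction_on with
  | empty => simp
  | cons a m ih =>
    simp only [Multiset.map_cons, Multiset.sum_cons, ih, mul_add, Finset.sum_add_distrib]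
    simp only [Finset.mul_sum, mul_left_comm]

/-! ### The symmetry defect of a Runge-Kutta scheme -/

namespace RKScheme

variable {s : ℕ} (Ψ : RKScheme s)

theorem derivativeWeight_node (F : Forest) (i : Fin s) :
    Ψ.derivativeWeight (RTree.node F) i =
      (F.map fun t => ∑ j, Ψ.A i j * Ψ.derivativeWeight t j).prod := by
  rw [derivativeWeight, RTree.fold_node, Multiset.map_map]
  rfl

theorem character_tree (τ : RTree) :
    Ψ.character (tree τ) = ∑ i, Ψ.b i * Ψ.derivativeWeight τ i :=
  MvPolynomial.aeval_X _ _

/-- The derivative weights, at the stages of `Ψ`, of the composition of the scheme with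
character `Ψ.character ∘ involution` and `Ψ`. -/
noncomputable def stageDefect (τ : RTree) (i : Fin s) : ℝ :=
  ((RTree.admissibleCuts τ).map fun c =>
    Ψ.character.comp involution (forest c.1) * Ψ.derivativeWeight c.2 i).sum

theorem symmetryDefect_tree (τ : RTree) :
    symmetryDefect Ψ.character (tree τ) =
      (-1) ^ τ.size * Ψ.character (tree τ) + ∑ i, Ψ.b i * Ψ.stageDefect τ i := by
  rw [symmetryDefect, convolution_tree, comp_involution_tree]
  simp only [stageDefect, character_tree, sum_map_mul_sum]

/-- Each child is either pruned whole, contributing its signed weight, or cut further inside the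
stages. Defects can thus be computed without listing cuts. -/
theorem stageDefect_node (F : Forest) (i : Fin s) :
    Ψ.stageDefect (RTree.node F) i =
      (F.map fun t => (-1) ^ t.size * Ψ.character (tree t) +
        ∑ j, Ψ.A i j * Ψ.stageDefect t j).prod := by
  have h := RTree.sum_map_forestCuts
    (fun c => Ψ.character.comp involution (forest c.1) * Ψ.derivativeWeight (RTree.node c.2) i)
    (by simp [forest_zero, derivativeWeight_node])
    (fun x y => by
      simp only [Prod.fst_add, Prod.snd_add, forest_add, map_mul, derivativeWeight_node,
        Multiset.map_add, Multiset.prod_add]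
      ring) F
  rw [stageDefect, RTree.admissibleCuts_node, Multiset.map_map]
  refine h.trans (congrArg _ (Multiset.map_congr rfl fun t _ => ?_))
  rw [forest_singleton, comp_involution_tree, derivativeWeight_node, Multiset.map_zero,
    Multiset.prod_zero, mul_one]
  congr 1
  simp only [derivativeWeight_node, Multiset.map_singleton, Multiset.prod_singleton,
    stageDefect, sum_map_mul_sum]

end RKScheme

open RTree

/-! ### Explicit three-stage schemes -/

/-- The explicit three-stage scheme with nodes `0, a, c`, matrix entry `a₃₂ = d` and weights
`b₁, b₂, b₃`. -/
noncomputable def explicitThreeStage (a c d b₁ b₂ b₃ : ℝ) : RKScheme 3 where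
  A := !![0, 0, 0; a, 0, 0; c - d, d, 0]
  b := ![b₁, b₂, b₃]

theorem isExplicit_explicitThreeStage (a c d b₁ b₂ b₃ : ℝ) :
    (explicitThreeStage a c d b₁ b₂ b₃).IsExplicit := by
  intro i j hij
  fin_cases i <;> fin_cases j <;> simp_all [explicitThreeStage]

theorem RKScheme.IsExplicit.eq_explicitThreeStage {Ψ : RKScheme 3} (h : Ψ.IsExplicit) :
    Ψ = explicitThreeStage (Ψ.A 1 0) (Ψ.A 2 0 + Ψ.A 2 1) (Ψ.A 2 1) (Ψ.b 0) (Ψ.b 1) (Ψ.b 2) := by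
  ext i j
  · fin_cases i <;> fin_cases j <;> simp [explicitThreeStage, h _ _ (le_refl _), h 0 1, h 0 2, h 1 2]
  · fin_cases i <;> simp [explicitThreeStage]

section

variable {a c d b₁ b₂ b₃ : ℝ}

local notation "Ψ" => explicitThreeStage a c d b₁ b₂ b₃

theorem derivativeWeight_singleton (t : RTree) {x y z : ℝ}
    (h : RKScheme.derivativeWeight Ψ t = ![x, y, z]) :
    RKScheme.derivativeWeight Ψ (node {t}) = ![0, a * x, (c - d) * x + d * y] := by
  ext i
  rw [RKScheme.derivativeWeight_node]
  simp only [Multiset.map_singleton, Multiset.prod_singleton, Fin.sum_univ_three, h]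
  fin_cases i <;> simp [explicitThreeStage]

theorem derivativeWeight_dot : RKScheme.derivativeWeight Ψ (node 0) = ![1, 1, 1] := by
  ext i
  rw [RKScheme.derivativeWeight_node]
  fin_cases i <;> simp

theorem derivativeWeight_cons (t : RTree) (F : Forest) (i : Fin 3) :
    RKScheme.derivativeWeight Ψ (node (t ::ₘ F)) i =
      RKScheme.derivativeWeight Ψ (node {t}) i * RKScheme.derivativeWeight Ψ (node F) i := by
  simp [RKScheme.derivativeWeight_node]

theorem derivativeWeight_chain2 : RKScheme.derivativeWeight Ψ chain2 = ![0, a, c] := by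
  rw [chain2, derivativeWeight_singleton _ derivativeWeight_dot]
  simp

theorem derivativeWeight_chain3 : RKScheme.derivativeWeight Ψ chain3 = ![0, 0, d * a] := by
  rw [chain3, derivativeWeight_singleton _ derivativeWeight_chain2]
  simp

theorem derivativeWeight_cherry : RKScheme.derivativeWeight Ψ cherry = ![0, a ^ 2, c ^ 2] := by
  ext i
  rw [cherry, Multiset.insert_eq_cons, derivativeWeight_cons]
  -- Both factors are weights of `node {node 0}`, which is `chain2` by definition.
  change _ * RKScheme.derivativeWeight Ψ chain2 i = _
  change RKScheme.derivativeWeight Ψ chain2 i * _ = _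
  rw [derivativeWeight_chain2]
  fin_cases i <;> simp [sq]

/-- The signed weight `w` enters through an equation, so that each use can supply a value already
simplified by the order conditions. -/
theorem stageDefect_singleton (t : RTree) {n : ℕ} {v w x y z : ℝ} (hn : t.size = n)
    (hv : RKScheme.character Ψ (tree t) = v) (hw : (-1) ^ n * v = w)
    (h : RKScheme.stageDefect Ψ t = ![x, y, z]) :
    RKScheme.stageDefect Ψ (node {t}) = ![w, w + a * x, w + (c - d) * x + d * y] := by
  subst hn hv hw
  ext i
  rw [RKScheme.stageDefect_node]
  simp only [Multiset.map_singleton, Multiset.prod_singleton, Fin.sum_univ_three, h]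
  fin_cases i <;> simp [explicitThreeStage, add_assoc]

theorem stageDefect_dot : RKScheme.stageDefect Ψ (node 0) = ![1, 1, 1] := by
  ext i
  rw [RKScheme.stageDefect_node]
  fin_cases i <;> simp

theorem stageDefect_cons (t : RTree) (F : Forest) (i : Fin 3) :
    RKScheme.stageDefect Ψ (node (t ::ₘ F)) i =
      RKScheme.stageDefect Ψ (node {t}) i * RKScheme.stageDefect Ψ (node F) i := by
  simp [RKScheme.stageDefect_node]

theorem character_of_derivativeWeight {t : RTree} {x y z : ℝ}
    (h : RKScheme.derivativeWeight Ψ t = ![x, y, z]) :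
    RKScheme.character Ψ (tree t) = b₁ * x + b₂ * y + b₃ * z := by
  rw [RKScheme.character_tree, h]
  simp [Fin.sum_univ_three, explicitThreeStage]

theorem symmetryDefect_of_stageDefect {t : RTree} {n : ℕ} {u v w x y z : ℝ} (hn : t.size = n)
    (hd : RKScheme.derivativeWeight Ψ t = ![u, v, w])
    (h : RKScheme.stageDefect Ψ t = ![x, y, z]) :
    symmetryDefect (RKScheme.character Ψ) (tree t) =
      (-1) ^ n * (b₁ * u + b₂ * v + b₃ * w) + (b₁ * x + b₂ * y + b₃ * z) := by
  rw [RKScheme.symmetryDefect_tree, h, character_of_derivativeWeight hd, hn]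
  simp [Fin.sum_univ_three, explicitThreeStage]

/-- The conditions of order two. -/
theorem order_two_iff :
    (∀ τ : RTree, τ.size ≤ 2 → RKScheme.character Ψ (tree τ) = 1 / (τ.factorial : ℝ)) ↔
      b₁ + b₂ + b₃ = 1 ∧ b₂ * a + b₃ * c = 1 / 2 := by
  have f1 : (node 0).factorial = 1 := by simp [factorial_node, size_node]
  have f2 : chain2.factorial = 2 := by simp [chain2, factorial_node, size_node]
  have e1 : RKScheme.character Ψ (tree (node 0)) = b₁ + b₂ + b₃ := by
    rw [character_of_derivativeWeight derivativeWeight_dot]; ring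
  have e2 : RKScheme.character Ψ (tree chain2) = b₂ * a + b₃ * c := by
    rw [character_of_derivativeWeight derivativeWeight_chain2]; ring
  constructor
  · intro h
    have h1 := h (node 0) (by simp [size_node])
    have h2 := h chain2 size_chain2.le
    rw [e1, f1] at h1
    rw [e2, f2] at h2
    exact ⟨by simpa using h1, by simpa using h2⟩
  · rintro ⟨h1, h2⟩ τ hτ
    have := size_pos τ
    obtain h | h : τ.size = 1 ∨ τ.size = 2 := by omega
    · rw [eq_of_size_eq_one h, e1, f1, h1]; norm_num
    · rw [eq_of_size_eq_two h, e2, f2, h2]; norm_num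

/-! ### Symmetry defects of small trees and the resulting equations -/

theorem stageDefect_chain2 (h1 : b₁ + b₂ + b₃ = 1) :
    RKScheme.stageDefect Ψ chain2 = ![-1, a - 1, c - 1] := by
  rw [chain2, stageDefect_singleton (node 0) (w := -1) size_node_zero
    (character_of_derivativeWeight derivativeWeight_dot) (by linear_combination -h1)
    stageDefect_dot]
  ext i
  fin_cases i <;> simp <;> ring

theorem stageDefect_chain3 (h1 : b₁ + b₂ + b₃ = 1) (h2 : b₂ * a + b₃ * c = 1 / 2) :
    RKScheme.stageDefect Ψ chain3 = ![1 / 2, 1 / 2 - a, 1 / 2 - c + d * a] := by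
  rw [chain3, stageDefect_singleton chain2 (w := 1 / 2) size_chain2
    (character_of_derivativeWeight derivativeWeight_chain2) (by linear_combination h2)
    (stageDefect_chain2 h1)]
  ext i
  fin_cases i <;> simp <;> ring

theorem stageDefect_cherry (h1 : b₁ + b₂ + b₃ = 1) :
    RKScheme.stageDefect Ψ cherry = ![1, (a - 1) ^ 2, (c - 1) ^ 2] := by
  ext i
  have h := stageDefect_cons (a := a) (c := c) (d := d) (b₁ := b₁) (b₂ := b₂) (b₃ := b₃)
    (node 0) {node 0} i
  rw [← Multiset.insert_eq_cons, ← cherry, ← chain2, stageDefect_chain2 h1] at h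
  rw [h]
  fin_cases i <;> simp [sq]

/-- On paths the defect is a coefficient of R(-z)R(z), where R = 1 + z + z²/2 + qz³ and q = b₃da;
that of z⁴ is 1/4 - 2q. -/
theorem symmetryDefect_node_chain3 (h1 : b₁ + b₂ + b₃ = 1) (h2 : b₂ * a + b₃ * c = 1 / 2) :
    symmetryDefect (RKScheme.character Ψ) (tree (node {chain3})) = 1 / 4 - 2 * (b₃ * d * a) := by
  rw [symmetryDefect_of_stageDefect (n := 4) (by simp [size_node, size_chain3])
    (derivativeWeight_singleton _ derivativeWeight_chain3)
    (stageDefect_singleton chain3 size_chain3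
      (character_of_derivativeWeight derivativeWeight_chain3) rfl (stageDefect_chain3 h1 h2))]
  linear_combination (-(b₃ * d * a)) * h1 + (1 / 2) * h2

theorem symmetryDefect_node_cherry (h1 : b₁ + b₂ + b₃ = 1) (h2 : b₂ * a + b₃ * c = 1 / 2) :
    symmetryDefect (RKScheme.character Ψ) (tree (node {cherry})) =
      2 * (b₃ * d * a ^ 2) - (b₂ * a ^ 2 + b₃ * c ^ 2) - 2 * (b₃ * d * a) + 1 / 2 := by
  rw [symmetryDefect_of_stageDefect (n := 4) (by simp [size_node, size_cherry])
    (derivativeWeight_singleton _ derivativeWeight_cherry)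
    (stageDefect_singleton cherry size_cherry
      (character_of_derivativeWeight derivativeWeight_cherry) rfl (stageDefect_cherry h1))]
  linear_combination (-(b₂ * a ^ 2 + b₃ * c ^ 2)) * h1 + h2

theorem symmetryDefect_node_dot_chain2 (h1 : b₁ + b₂ + b₃ = 1) (h2 : b₂ * a + b₃ * c = 1 / 2) :
    symmetryDefect (RKScheme.character Ψ) (tree (node {node 0, chain2})) =
      2 * (b₃ * c * d * a) - (b₂ * a ^ 2 + b₃ * c ^ 2) - b₃ * d * a + 1 / 4 := by
  have hd : RKScheme.derivativeWeight Ψ (node {node 0, chain2}) = ![0, 0, c * (d * a)] := by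
    ext i
    rw [Multiset.insert_eq_cons, derivativeWeight_cons, ← chain2, ← chain3,
      derivativeWeight_chain2, derivativeWeight_chain3]
    fin_cases i <;> simp
  have hs : RKScheme.stageDefect Ψ (node {node 0, chain2}) =
      ![-1 / 2, (a - 1) * (1 / 2 - a), (c - 1) * (1 / 2 - c + d * a)] := by
    ext i
    rw [Multiset.insert_eq_cons, stageDefect_cons, ← chain2, ← chain3,
      stageDefect_chain2 h1, stageDefect_chain3 h1 h2]
    fin_cases i <;> simp
    ring
  rw [symmetryDefect_of_stageDefect (n := 4) (by simp [size_node, size_chain2]) hd hs]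
  linear_combination (-1 / 2) * h1 + (3 / 2) * h2

theorem symmetryDefect_node_dot_dot_dot (h1 : b₁ + b₂ + b₃ = 1)
    (h2 : b₂ * a + b₃ * c = 1 / 2) :
    symmetryDefect (RKScheme.character Ψ) (tree (node {node 0, node 0, node 0})) =
      2 * (b₂ * a ^ 3 + b₃ * c ^ 3) - 3 * (b₂ * a ^ 2 + b₃ * c ^ 2) + 1 / 2 := by
  have hd : RKScheme.derivativeWeight Ψ (node {node 0, node 0, node 0}) =
      ![0, a ^ 3, c ^ 3] := by
    ext i
    rw [Multiset.insert_eq_cons, derivativeWeight_cons, ← chain2, ← cherry,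
      derivativeWeight_chain2, derivativeWeight_cherry]
    fin_cases i <;> simp <;> ring
  have hs : RKScheme.stageDefect Ψ (node {node 0, node 0, node 0}) =
      ![-1, (a - 1) ^ 3, (c - 1) ^ 3] := by
    ext i
    rw [Multiset.insert_eq_cons, stageDefect_cons, ← chain2, ← cherry,
      stageDefect_chain2 h1, stageDefect_cherry h1]
    fin_cases i <;> simp <;> ring
  rw [symmetryDefect_of_stageDefect (n := 4) (by simp [size_node]) hd hs]
  linear_combination -h1 + 3 * h2

theorem symmetryDefect_chain2 (h1 : b₁ + b₂ + b₃ = 1) (h2 : b₂ * a + b₃ * c = 1 / 2) :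
    symmetryDefect (RKScheme.character Ψ) (tree chain2) = 0 := by
  rw [symmetryDefect_of_stageDefect size_chain2 derivativeWeight_chain2 (stageDefect_chain2 h1)]
  linear_combination -h1 + 2 * h2

/-- Among the conditions of antisymmetric order five, those on the trees with four vertices
imply the others. -/
theorem agreeUpTo_five_iff (h1 : b₁ + b₂ + b₃ = 1) (h2 : b₂ * a + b₃ * c = 1 / 2) :
    AgreeUpTo 5 (symmetryDefect (RKScheme.character Ψ)) (convUnit ℝ) ↔
      b₃ * d * a = 1 / 8 ∧ 2 * (b₃ * d * a ^ 2) = b₂ * a ^ 2 + b₃ * c ^ 2 - 1 / 4 ∧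
        2 * (b₃ * c * d * a) = b₂ * a ^ 2 + b₃ * c ^ 2 - 1 / 8 ∧
        2 * (b₂ * a ^ 3 + b₃ * c ^ 3) = 3 * (b₂ * a ^ 2 + b₃ * c ^ 2) - 1 / 2 := by
  constructor
  · intro h
    have e1 := h (node {chain3}) (by simp [size_node, size_chain3])
    have e2 := h (node {cherry}) (by simp [size_node, size_cherry])
    have e3 := h (node {node 0, chain2}) (by simp [size_node, size_chain2])
    have e4 := h (node {node 0, node 0, node 0}) (by simp [size_node])
    rw [symmetryDefect_node_chain3 h1 h2, convUnit_tree] at e1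
    rw [symmetryDefect_node_cherry h1 h2, convUnit_tree] at e2
    rw [symmetryDefect_node_dot_chain2 h1 h2, convUnit_tree] at e3
    rw [symmetryDefect_node_dot_dot_dot h1 h2, convUnit_tree] at e4
    refine ⟨?_, ?_, ?_, ?_⟩ <;> linarith
  · rintro ⟨e1, e2, e3, e4⟩
    have a1 : AgreeUpTo 1 (symmetryDefect (RKScheme.character Ψ)) (convUnit ℝ) :=
      agreeUpTo_symmetryDefect_succ Even.zero fun τ hτ => absurd hτ (size_pos τ).not_ge
    have a2 : AgreeUpTo 2 (symmetryDefect (RKScheme.character Ψ)) (convUnit ℝ) := by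
      intro τ hτ
      rcases hτ.lt_or_eq with h | h
      · exact a1 τ (by omega)
      · rw [eq_of_size_eq_two h, symmetryDefect_chain2 h1 h2, convUnit_tree]
    have a3 := agreeUpTo_symmetryDefect_succ even_two a2
    refine agreeUpTo_symmetryDefect_succ (n := 4) (by decide) fun τ hτ => ?_
    rcases hτ.lt_or_eq with h | h
    · exact a3 τ (by omega)
    · rw [convUnit_tree]
      rcases eq_of_size_eq_four h with rfl | rfl | rfl | rfl
      · rw [symmetryDefect_node_chain3 h1 h2]; linarith
      · rw [symmetryDefect_node_cherry h1 h2]; linarith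
      · rw [symmetryDefect_node_dot_chain2 h1 h2]; linarith
      · rw [symmetryDefect_node_dot_dot_dot h1 h2]; linarith

/-- The path on six vertices has defect -q² = -1/64, with q = b₃da. -/
theorem not_agreeUpTo_six (h1 : b₁ + b₂ + b₃ = 1) (h2 : b₂ * a + b₃ * c = 1 / 2)
    (hq : b₃ * d * a = 1 / 8) :
    ¬AgreeUpTo 6 (symmetryDefect (RKScheme.character Ψ)) (convUnit ℝ) := by
  intro h
  have h6 := h (node {node {node {chain3}}}) (by simp [size_node, size_chain3])
  have d4 := derivativeWeight_singleton _ (derivativeWeight_chain3 (a := a) (c := c) (d := d)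
    (b₁ := b₁) (b₂ := b₂) (b₃ := b₃))
  have d5 := derivativeWeight_singleton _ d4
  have d6 := derivativeWeight_singleton _ d5
  have s4 : RKScheme.stageDefect Ψ (node {chain3}) = _ := stageDefect_singleton chain3 (w := -(1 / 8)) size_chain3
    (character_of_derivativeWeight derivativeWeight_chain3) (by linear_combination -hq)
    (stageDefect_chain3 h1 h2)
  -- Paths with four or more vertices have weight zero in an explicit three-stage scheme, hence `w
  -- := 0` from here on.
  have s5 := stageDefect_singleton (n := 4) (w := 0) _ (by simp [size_node, size_chain3])
    (character_of_derivativeWeight d4) (by ring) s4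
  have s6 := stageDefect_singleton (n := 5) (w := 0) _ (by simp [size_node, size_chain3])
    (character_of_derivativeWeight d5) (by ring) s5
  rw [symmetryDefect_of_stageDefect (n := 6) (by simp [size_node, size_chain3]) d6 s6,
    convUnit_tree] at h6
  have : (0 : ℝ) = 1 / 64 := by linear_combination h6 + (1 / 8) * hq
  norm_num at this

theorem order_character_eq_two_iff :
    order (RKScheme.character Ψ) = (2 : ℕ) ↔
      (b₁ + b₂ + b₃ = 1 ∧ b₂ * a + b₃ * c = 1 / 2) ∧
        ¬∀ τ : RTree, τ.size ≤ 3 → RKScheme.character Ψ (tree τ) = 1 / (τ.factorial : ℝ) := by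
  rw [order_eq_iff, order_two_iff]

/-- Order three asks for 1/6 on the path with three vertices, where the weight is 1/8. -/
theorem not_order_three (hq : b₃ * d * a = 1 / 8) :
    ¬∀ τ : RTree, τ.size ≤ 3 → RKScheme.character Ψ (tree τ) = 1 / (τ.factorial : ℝ) := by
  intro h
  have h3 := h chain3 size_chain3.le
  have f3 : chain3.factorial = 6 := by simp [chain3, chain2, factorial_node, size_node]
  rw [character_of_derivativeWeight derivativeWeight_chain3, f3] at h3
  norm_num at h3
  linarith

end

/-- An explicit three-stage scheme is in the class `EES(2, 5)` if and only if its coefficients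
satisfy the conditions of order two and those of antisymmetric order four. -/
theorem explicitThreeStage_mem_EESClass_iff {a c d b₁ b₂ b₃ : ℝ} :
    explicitThreeStage a c d b₁ b₂ b₃ ∈ EESClass 3 2 5 ↔
      (b₁ + b₂ + b₃ = 1 ∧ b₂ * a + b₃ * c = 1 / 2) ∧
      b₃ * d * a = 1 / 8 ∧ 2 * (b₃ * d * a ^ 2) = b₂ * a ^ 2 + b₃ * c ^ 2 - 1 / 4 ∧
        2 * (b₃ * c * d * a) = b₂ * a ^ 2 + b₃ * c ^ 2 - 1 / 8 ∧
        2 * (b₂ * a ^ 3 + b₃ * c ^ 3) = 3 * (b₂ * a ^ 2 + b₃ * c ^ 2) - 1 / 2 := by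
  rw [EESClass, Set.mem_ofPred_eq, order_character_eq_two_iff, antisymmetricOrder_eq_iff]
  constructor
  · rintro ⟨-, ⟨⟨h1, h2⟩, -⟩, h5, -⟩
    exact ⟨⟨h1, h2⟩, (agreeUpTo_five_iff h1 h2).1 h5⟩
  · rintro ⟨⟨h1, h2⟩, h⟩
    exact ⟨isExplicit_explicitThreeStage a c d b₁ b₂ b₃, ⟨⟨h1, h2⟩, not_order_three h.1⟩,
      (agreeUpTo_five_iff h1 h2).2 h, not_agreeUpTo_six h1 h2 h.1⟩

/-! ### The one-parameter family -/

theorem EES25_eq_explicitThreeStage {x : ℝ} (hx : x ≠ 1) (hx1 : x ≠ 1 / 2)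
    (hx2 : x ≠ -(1 / 2)) :
    EES25 x = explicitThreeStage ((1 + 2 * x) / (4 * (1 - x))) (3 / (4 * (1 - x)))
      ((1 - x) / (1 - 4 * x ^ 2)) x (1 / 2) (1 / 2 - x) := by
  have n1 : 1 - x ≠ 0 := sub_ne_zero.2 hx.symm
  have n2 : 1 - 4 * x ^ 2 ≠ 0 := by
    rw [show 1 - 4 * x ^ 2 = 4 * ((1 / 2 - x) * (x - -(1 / 2))) by ring]
    exact mul_ne_zero (by norm_num) (mul_ne_zero (sub_ne_zero.2 hx1.symm) (sub_ne_zero.2 hx2))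
  have key : (4 * x - 1) ^ 2 / (4 * (x - 1) * (1 - 4 * x ^ 2)) =
      3 / (4 * (1 - x)) - (1 - x) / (1 - 4 * x ^ 2) := by
    rw [show x - 1 = -(1 - x) by ring]
    field_simp
    ring
  rw [EES25, key]
  rfl

theorem EES25_mem_EESClass {x : ℝ} (hx : x ≠ 1) (hx1 : x ≠ 1 / 2) (hx2 : x ≠ -(1 / 2)) :
    EES25 x ∈ EESClass 3 2 5 := by
  have n1 : 1 - x ≠ 0 := sub_ne_zero.2 hx.symm
  have n2 : 1 - 4 * x ^ 2 ≠ 0 := by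
    rw [show 1 - 4 * x ^ 2 = 4 * ((1 / 2 - x) * (x - -(1 / 2))) by ring]
    exact mul_ne_zero (by norm_num) (mul_ne_zero (sub_ne_zero.2 hx1.symm) (sub_ne_zero.2 hx2))
  rw [EES25_eq_explicitThreeStage hx hx1 hx2, explicitThreeStage_mem_EESClass_iff]
  have hc : 3 / (4 * (1 - x)) = (1 + 2 * x) / (4 * (1 - x)) + 1 / 2 := by
    field_simp
    ring
  have ha : 4 * (1 - x) * ((1 + 2 * x) / (4 * (1 - x))) = 1 + 2 * x := by field_simp
  have hd : (1 - x) / (1 - 4 * x ^ 2) * (1 - 4 * x ^ 2) = 1 - x := div_mul_cancel₀ _ n2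
  rw [hc]
  -- Only `ha` and `hd`, now polynomial relations, are needed about these quotients; all conditions
  -- follow from them without division.
  generalize (1 + 2 * x) / (4 * (1 - x)) = a at *
  generalize (1 - x) / (1 - 4 * x ^ 2) = d at *
  have hq : (1 / 2 - x) * d * a = 1 / 8 :=
    mul_left_cancel₀ n1 (by linear_combination (1 / 8) * hd + (1 / 4) * (1 / 2 - x) * d * ha)
  have hb : (1 / 2 - x) * (a + 1 / 2) = (1 - a) / 2 := by linear_combination (1 / 4) * ha
  refine ⟨⟨by ring, by linear_combination hb⟩, hq, ?_, ?_, ?_⟩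
  · linear_combination 2 * a * hq - (a + 1 / 2) * hb
  · linear_combination 2 * (a + 1 / 2) * hq - (a + 1 / 2) * hb
  · linear_combination (2 * (a + 1 / 2) ^ 2 - 3 * (a + 1 / 2)) * hb

theorem exists_eq_EES25 {Ψ : RKScheme 3} (h : Ψ ∈ EESClass 3 2 5) :
    ∃ x : ℝ, x ≠ 1 ∧ x ≠ 1 / 2 ∧ x ≠ -(1 / 2) ∧ Ψ = EES25 x := by
  have hΨ := h.1.eq_explicitThreeStage
  rw [hΨ] at h ⊢
  clear hΨ
  generalize Ψ.A 2 0 + Ψ.A 2 1 = c at h ⊢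
  generalize Ψ.A 1 0 = a, Ψ.A 2 1 = d, Ψ.b 0 = x, Ψ.b 1 = b₂,
    Ψ.b 2 = b₃ at h ⊢
  rw [explicitThreeStage_mem_EESClass_iff] at h
  obtain ⟨⟨h1, h2⟩, e1, e2, e3, -⟩ := h
  -- Subtracting `e2` from `e3` leaves 2(b₃da)(c - a) = 1/8, and b₃da = 1/8.
  have hc : c = a + 1 / 2 := by linear_combination 4 * e3 - 4 * e2 - 8 * (c - a) * e1
  subst hc
  have ha : a ≠ 0 := by rintro rfl; norm_num at e1
  have hb3 : b₃ ≠ 0 := by rintro rfl; norm_num at e1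
  -- Subtracting a times `h2` from `e2` removes b₂ and leaves b₃c(c - a), with c - a = 1/2.
  have k1 : b₃ * (a + 1 / 2) = (1 - a) / 2 := by
    linear_combination -2 * e2 + 4 * a * e1 - 2 * a * h2
  have hb2 : b₂ = 1 / 2 := mul_right_cancel₀ ha (by linear_combination h2 - k1)
  subst hb2
  have hb3' : b₃ = 1 / 2 - x := by linear_combination h1
  subst hb3'
  -- `k1` with b₃ = 1/2 - x is linear in a. The three excluded x are those where it has no solution
  -- (x = 1), b₃ = 0 (x = 1/2), or a = 0 (x = -1/2).
  have k2 : 4 * (1 - x) * a = 1 + 2 * x := by linear_combination 4 * k1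
  have hx : x ≠ 1 := by rintro rfl; norm_num at k2
  have hx1 : x ≠ 1 / 2 := by rintro rfl; exact hb3 (by ring)
  have hx2 : x ≠ -(1 / 2) := by
    rintro rfl
    exact ha (by linear_combination (1 / 6) * k2)
  have n1 : 1 - x ≠ 0 := sub_ne_zero.2 hx.symm
  have n2 : 1 - 4 * x ^ 2 ≠ 0 := by
    rw [show 1 - 4 * x ^ 2 = 4 * ((1 / 2 - x) * (x - -(1 / 2))) by ring]
    exact mul_ne_zero (by norm_num) (mul_ne_zero (sub_ne_zero.2 hx1.symm) (sub_ne_zero.2 hx2))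
  have ha' : a = (1 + 2 * x) / (4 * (1 - x)) := by
    rw [eq_div_iff (mul_ne_zero (by norm_num) n1)]
    linear_combination k2
  have hc' : a + 1 / 2 = 3 / (4 * (1 - x)) := by
    rw [ha']
    field_simp
    ring
  have hd' : d = (1 - x) / (1 - 4 * x ^ 2) := by
    rw [eq_div_iff n2]
    linear_combination 8 * (1 - x) * e1 - 2 * (1 / 2 - x) * d * k2
  refine ⟨x, hx, hx1, hx2, ?_⟩
  rw [EES25_eq_explicitThreeStage hx hx1 hx2, hc', ← hd', ← ha']

theorem EES25_c {x : ℝ} (hx : x ≠ 1) (hx1 : x ≠ 1 / 2) (hx2 : x ≠ -(1 / 2)) :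
    (EES25 x).c = ![0, (1 + 2 * x) / (4 * (1 - x)), 3 / (4 * (1 - x))] := by
  rw [EES25_eq_explicitThreeStage hx hx1 hx2]
  ext i
  rw [RKScheme.c]
  fin_cases i <;> simp [explicitThreeStage, Fin.sum_univ_three]

end EES

theorem mainTheorem7 :
    EES.EESClass 3 2 5 = {Ψ | ∃ x : ℝ, x ≠ 1 ∧ x ≠ 1 / 2 ∧ x ≠ -(1 / 2) ∧ Ψ = EES.EES25 x} ∧
    (∀ x : ℝ, x ≠ 1 → x ≠ 1 / 2 → x ≠ -(1 / 2) →
      (EES.EES25 x).c = ![0, (1 + 2 * x) / (4 * (1 - x)), 3 / (4 * (1 - x))]) ∧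
    (EES.EES25 (1 / 4) = ⟨!![0, 0, 0; 1 / 2, 0, 0; 0, 1, 0], ![1 / 4, 1 / 2, 1 / 4]⟩ ∧
      (EES.EES25 (1 / 4)).c = ![0, 1 / 2, 1]) ∧
    (EES.EES25 (1 / 10) =
        ⟨!![0, 0, 0; 1 / 3, 0, 0; -(5 / 48), 15 / 16, 0], ![1 / 10, 1 / 2, 2 / 5]⟩ ∧
      (EES.EES25 (1 / 10)).c = ![0, 1 / 3, 5 / 6]) := by
  refine ⟨?_, fun x => EES.EES25_c, ⟨?_, ?_⟩, ?_, ?_⟩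
  · ext Ψ
    constructor
    · exact EES.exists_eq_EES25
    · rintro ⟨x, hx, hx1, hx2, rfl⟩
      exact EES.EES25_mem_EESClass hx hx1 hx2
  · rw [EES.EES25]
    norm_num
  · rw [EES.EES25_c (by norm_num) (by norm_num) (by norm_num)]
    norm_num
  · rw [EES.EES25]
    norm_num
  · rw [EES.EES25_c (by norm_num) (by norm_num) (by norm_num)]
    norm_num
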